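/- Identify $\mathbb R^2$ with the plane with polar coordinates $(r,\theta)$ centred at $O=0$, and let $\Xi=\{y>0\}$. Let $\sigma_+>0>\sigma_-$ be constants with $\sigma_- /\sigma_+\in(-1,-1/3)$, put $a=\frac12\frac{\sigma_+-\sigma_-}{\sigma_++\sigma_-}>1$ and $$\mu=-\tfrac2\pi\ln\big(a-\sqrt{a^2-1}\big)>0 .$$ Let $\phi(\theta)=c_\phi\frac{\sinh(\mu\theta)}{\sinh(\mu\pi/4)}$ on $[0,\pi/4]$ and $\phi(\theta)=c_\phi\frac{\sinh(\mu(\pi-\theta))}{\sinh(3\mu\pi/4)}$ on $[\pi/4,\pi]$, where $c_\phi\in\mathbb R$ is chosen so that $\mu\int_0^\pi\sigma^0(\theta)\phi(\theta)^2\,d\theta=1$, with $\sigma^0(\theta)=\sigma_-$ for $\theta<\pi/4$ and $\sigma^0(\theta)=\sigma_+$ for $\theta>\pi/4$. Let $\psi\in C^\infty(\mathbb R;[0,1])$ with $\psi(r)=1$ for $r\le1$ and $\psi(r)=0$ for $r\ge2$, let $\chi=1-\psi$, and let $\beta\in(0,2)$. (1) *Outer problem.* Let $\Omega\subset\mathbb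 R^2$ be a bounded connected open set with Lipschitz boundary containing $\{|x|<2\}\cap\Xi$, cut by a straight segment $\Sigma^0=[O,O']$, which meets $\partial\Omega$ exactly at its two end points $O$ and $O'\ne O$, into two disjoint open sets $\Omega_\pm$ with $\Omega_+\cup\Omega_-=\Omega\setminus\Sigma^0$ and $\overline{\Omega_+}\cap\overline{\Omega_-}=\Sigma^0$. Assume that $\Omega_-$ and $\Omega_+$ coincide in $\{|x|<2\}$ with the sectors $\{0<\theta<\pi/4\}$ and $\{\pi/4<\theta<\pi\}$, and that near $O'$ the boundary $\partial\Omega$ is straight and perpendicular to $\Sigma^0$. Let $\sigma^0=\sigma_\pm$ in $\Omega_\pm$. For $\gamma\in\mathbb R$ let $\mathring V^1_\gamma(\Omega)$ be the completion of $C_0^\infty(\Omega)$ for the norm $\big(\int_\Omega r^{2(\gamma-1)}|v|^2+r^{2\gamma}|\nabla v|^2\,dx\big)^{1/2}$. Suppose that $\zeta\in\mathring V^1_\beta(\Omega)$ satisfies $\int_\Omega\sigma^0\nabla\zeta\cdot\overline{\nabla v}\,dx=0$ for all $v\in\mathring V^1_{-\beta}(\Omega)$ and that, for some $c_\zeta\in\mathbb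 C$, $$\zeta=\psi(r)r^{-i\mu}\phi(\theta)+c_\zeta\,\psi(r)r^{i\mu}\phi(\theta)+\tilde\zeta,\qquad \tilde\zeta\in\mathring V^1_{-\beta}(\Omega).$$ Then $|c_\zeta|=1$. (2) *Inner problem.* Let $\Gamma=\{\varphi_\Gamma(t):t\ge0\}$, with $\varphi_\Gamma:[0,\infty)\to\mathbb R^2$ of class $C^\infty$, $\varphi_\Gamma'(0)$ orthogonal to the $x$-axis and $\varphi_\Gamma(t)=(t,t)$ for $t\ge1$. Let $\Xi_\pm$ be disjoint open sets with $\Xi_+\cup\Xi_-=\Xi\setminus\Gamma$ and $\overline{\Xi_+}\cap\overline{\Xi_-}=\Gamma$ such that, outside some disc centred at $O$, $\Xi_-$ contains the sector $\{0<\theta<\pi/4\}$ and $\Xi_+$ contains the sector $\{\pi/4<\theta<\pi\}$. Let $\sigma^\infty=\sigma_\pm$ in $\Xi_\pm$. For $\gamma\in\mathbb R$ let $\mathring{\mathcal V}^1_\gamma(\Xi)$ be the completion of $C_0^\infty(\Xi)$ for the norm $\big(\int_\Xi(1+r)^{2(\gamma-1)}|v|^2+(1+r)^{2\gamma}|\nabla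 v|^2\,dx\big)^{1/2}$. Suppose that $Z\in\mathring{\mathcal V}^1_{-\beta}(\Xi)$ satisfies $\int_\Xi\sigma^\infty\nabla Z\cdot\overline{\nabla v}\,dx=0$ for all $v\in\mathring{\mathcal V}^1_{\beta}(\Xi)$ and that, for some $C_Z\in\mathbb C$, $$Z=\chi(r)r^{i\mu}\phi(\theta)+C_Z\,\chi(r)r^{-i\mu}\phi(\theta)+\tilde Z,\qquad \tilde Z\in\mathring{\mathcal V}^1_{\beta}(\Xi).$$ Then $|C_Z|=1$. -/

import Mathlib

open MeasureTheory Filter Topology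
open scoped ContDiff ENNReal

noncomputable section

namespace SignChanging

/-! The plane `ℝ²` is identified with `ℂ`: `x = re z`, `y = im z`, `r = ‖z‖`, `θ = arg z`,
and partial derivatives are taken over `ℝ` in the directions `1` and `I`. -/

/-! ### Test functions, gradients, weighted spaces -/

/-- `f ∈ C₀^∞(Ω)`, with complex values. -/
def IsTest (Ω : Set ℂ) (f : ℂ → ℂ) : Prop :=
  ContDiff ℝ ∞ f ∧ HasCompactSupport f ∧ tsupport f ⊆ Ω

/-- The classical gradient `(∂ₓ f, ∂_y f)`. -/
def grad (f : ℂ → ℂ) (z : ℂ) : ℂ × ℂ :=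
  (fderiv ℝ f z 1, fderiv ℝ f z Complex.I)

/-- `G = (G₁, G₂)` is the distributional gradient of `v` in `Ω`. -/
def IsWeakGrad (Ω : Set ℂ) (v : ℂ → ℂ) (G : ℂ → ℂ × ℂ) : Prop :=
  LocallyIntegrableOn v Ω volume ∧
  LocallyIntegrableOn (fun z => (G z).1) Ω volume ∧
  LocallyIntegrableOn (fun z => (G z).2) Ω volume ∧
  ∀ f : ℂ → ℂ, IsTest Ω f →
    (∫ z in Ω, v z * (grad f z).1 = -∫ z in Ω, (G z).1 * f z) ∧
    (∫ z in Ω, v z * (grad f z).2 = -∫ z in Ω, (G z).2 * f z)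

/-- The squared weighted norm `∫_Ω w^{2(β-1)} |v|² + w^{2β} |G|²`, where `G` is the gradient
of `v`. The weight `w` is `r` in the outer domain and `1 + ρ` in the inner domain. -/
def weightedNormSq (Ω : Set ℂ) (w : ℂ → ℝ) (β : ℝ) (v : ℂ → ℂ) (G : ℂ → ℂ × ℂ) : ℝ≥0∞ :=
  ∫⁻ z in Ω, ENNReal.ofReal
    (w z ^ (2 * (β - 1)) * ‖v z‖ ^ 2 + w z ^ (2 * β) * (‖(G z).1‖ ^ 2 + ‖(G z).2‖ ^ 2))

/-- The weighted space with homogeneous Dirichlet condition: the completion of `C₀^∞(Ω)` for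
the weighted norm, realised as a set of functions on `Ω` (the values of `v` outside `Ω` play
no role). -/
def MemV (Ω : Set ℂ) (w : ℂ → ℝ) (β : ℝ) (v : ℂ → ℂ) : Prop :=
  ∃ G : ℂ → ℂ × ℂ, IsWeakGrad Ω v G ∧
    ∃ f : ℕ → ℂ → ℂ, (∀ n, IsTest Ω (f n)) ∧
      Tendsto (fun n => weightedNormSq Ω w β (fun z => v z - f n z) (fun z => G z - grad (f n) z))
        atTop (𝓝 0)

/-- `(σ ∇u, ∇v)_Ω`, in terms of the gradients `G` of `u` and `H` of `v`. -/
def form (Ω : Set ℂ) (σ : ℂ → ℝ) (G H : ℂ → ℂ × ℂ) : ℂ :=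
  ∫ z in Ω, (σ z : ℂ) *
    ((G z).1 * starRingEnd ℂ (H z).1 + (G z).2 * starRingEnd ℂ (H z).2)

/-- `u` lies in the kernel of the operator from the space with exponent `β` to the antidual of
the space with exponent `-β` given by `⟨A u, v⟩ = (σ ∇u, ∇v)_Ω`. -/
def MemKer (Ω : Set ℂ) (σ : ℂ → ℝ) (w : ℂ → ℝ) (β : ℝ) (u : ℂ → ℂ) : Prop :=
  MemV Ω w β u ∧
  ∀ G : ℂ → ℂ × ℂ, IsWeakGrad Ω u G →
    ∀ (v : ℂ → ℂ) (H : ℂ → ℂ × ℂ), MemV Ω w (-β) v → IsWeakGrad Ω v H →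
      form Ω σ G H = 0

/-- Weight of the outer domain. -/
def outerWeight (z : ℂ) : ℝ := ‖z‖

/-- Weight of the inner domain. -/
def innerWeight (z : ℂ) : ℝ := 1 + ‖z‖

/-! ### Geometry -/

/-- The open sector `{a < θ < b, 0 < r}` (for `-π ≤ a`, `b ≤ π`). -/
def sector (a b : ℝ) : Set ℂ := {z | z ≠ 0 ∧ a < z.arg ∧ z.arg < b}

/-- The upper half plane `Ξ`. -/
def Xi : Set ℂ := {z | 0 < z.im}

/-- `Ω` has a Lipschitz boundary: near each boundary point, in suitable Cartesian coordinates
`(s, t)` centred at the point, `Ω` is the region above the graph of a Lipschitz function. -/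
def HasLipschitzBoundary (Ω : Set ℂ) : Prop :=
  ∀ x ∈ frontier Ω, ∃ (e : ℂ) (K : NNReal) (g : ℝ → ℝ) (a h : ℝ),
    ‖e‖ = 1 ∧ LipschitzWith K g ∧ 0 < a ∧ 0 < h ∧
    ∀ s t : ℝ, |s| < a → |t| < h → (x + e * (s + t * Complex.I) ∈ Ω ↔ g s < t)

/-- Outer limit geometry: a bounded Lipschitz domain `Ω`, cut by the straight segment
`Σ⁰ = [O, O']` (with `O = 0`) into `Ω₊` and `Ω₋`. -/
structure OuterGeometry (Ω Ωp Ωm : Set ℂ) (O' : ℂ) : Prop where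
  isOpen : IsOpen Ω
  isConnected : IsConnected Ω
  isBounded : Bornology.IsBounded Ω
  lipschitz : HasLipschitzBoundary Ω
  isOpen_p : IsOpen Ωp
  isOpen_m : IsOpen Ωm
  disjoint : Disjoint Ωp Ωm
  union : Ωp ∪ Ωm = Ω \ segment ℝ 0 O'
  interface : closure Ωp ∩ closure Ωm = segment ℝ 0 O'
  ne : O' ≠ 0
  endpoints : segment ℝ 0 O' ∩ frontier Ω = {0, O'}
  /-- Near `O'` the boundary is straight and perpendicular to the segment. -/
  perp : ∃ ε > 0, Ω ∩ Metric.ball O' ε =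
    {z | ((z - O') * starRingEnd ℂ O').re < 0} ∩ Metric.ball O' ε
  halfDisc : Xi ∩ Metric.ball 0 2 ⊆ Ω
  corner_m : Ωm ∩ Metric.ball 0 2 = sector 0 (Real.pi / 4) ∩ Metric.ball 0 2
  corner_p : Ωp ∩ Metric.ball 0 2 = sector (Real.pi / 4) Real.pi ∩ Metric.ball 0 2

/-- Inner limit geometry: the half plane `Ξ`, cut by the smooth curve `Γ = γ([0, ∞))` into
`Ξ₊` and `Ξ₋`. -/
structure InnerGeometry (Ξp Ξm : Set ℂ) (γ : ℝ → ℂ) : Prop where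
  isOpen_p : IsOpen Ξp
  isOpen_m : IsOpen Ξm
  disjoint : Disjoint Ξp Ξm
  union : Ξp ∪ Ξm = Xi \ γ '' Set.Ici 0
  interface : closure Ξp ∩ closure Ξm = γ '' Set.Ici 0
  smooth : ContDiffOn ℝ ∞ γ (Set.Ici 0)
  /-- The tangent at the starting point is orthogonal to the `x`-axis. -/
  perp : (derivWithin γ (Set.Ici 0) 0).re = 0
  diagonal : ∀ t : ℝ, 1 ≤ t → γ t = t + t * Complex.I
  /-- Far from the origin, `Ξ₋` lies below the diagonal and `Ξ₊` above. -/
  far : ∃ R : ℝ, (∀ z ∈ sector 0 (Real.pi / 4), R < ‖z‖ → z ∈ Ξm) ∧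
    (∀ z ∈ sector (Real.pi / 4) Real.pi, R < ‖z‖ → z ∈ Ξp)

open Classical in
/-- The piecewise constant coefficient: `σ₊` in the set `P`, `σ₋` in the set `M`. -/
def coeff (σp σm : ℝ) (P M : Set ℂ) (z : ℂ) : ℝ :=
  if z ∈ P then σp else if z ∈ M then σm else 0

/-! ### Singular exponent and singular functions -/

/-- The number `a = (1/2) (σ₊ - σ₋) / (σ₊ + σ₋)`; it is `> 1` when `-1 < σ₋/σ₊ < -1/3`. -/
def contrast (σp σm : ℝ) : ℝ := (1 / 2) * ((σp - σm) / (σp + σm))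

/-- The exponent `μ = -(2/π) ln (a + i √(1 - a²))`, where `i √(1 - a²) = -√(a² - 1)`. Equivalently,
`μ > 0` and `cosh (π μ / 2) = a`; for this `μ` the function `φ` below satisfies the transmission
condition `σ₋ φ' = σ₊ φ'` at `θ = π/4`. -/
def mu (σp σm : ℝ) : ℝ :=
  -(2 / Real.pi) * Real.log (contrast σp σm - √(contrast σp σm ^ 2 - 1))

/-- The angular function `φ`, with multiplicative constant `c`. -/
def phi (μ c θ : ℝ) : ℝ :=
  if θ ≤ Real.pi / 4 then c * (Real.sinh (μ * θ) / Real.sinh (μ * (Real.pi / 4)))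
  else c * (Real.sinh (μ * (Real.pi - θ)) / Real.sinh (μ * (3 * Real.pi / 4)))

/-- The coefficient near the corner as a function of the angle. -/
def sigmaAngle (σp σm θ : ℝ) : ℝ := if θ < Real.pi / 4 then σm else σp

/-- The normalization `μ ∫₀^π σ⁰ φ² = 1`. -/
def IsNormalized (σp σm c : ℝ) : Prop :=
  mu σp σm * ∫ θ in (0 : ℝ)..Real.pi, sigmaAngle σp σm θ * phi (mu σp σm) c θ ^ 2 = 1

/-- The function `r^{i s} φ(θ)`. -/
def singular (s μ c : ℝ) (z : ℂ) : ℂ :=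
  (‖z‖ : ℂ) ^ (Complex.I * s) * phi μ c z.arg

/-- The cut-off function `ψ`: smooth, with values in `[0, 1]`, equal to `1` for `r ≤ 1` and to
`0` for `r ≥ 2`. -/
def IsCutoff (ψ : ℝ → ℝ) : Prop :=
  ContDiff ℝ ∞ ψ ∧ (∀ r, ψ r ∈ Set.Icc (0 : ℝ) 1) ∧ (∀ r ≤ 1, ψ r = 1) ∧ ∀ r, 2 ≤ r → ψ r = 0

/-- `ζ = ψ r^{-iμ} φ + c_ζ ψ r^{iμ} φ + ζ̃` in `Ω`, with `ζ̃` in the space of exponent `-β`. -/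
def OuterExpansion (Ω : Set ℂ) (ψ : ℝ → ℝ) (β μ c : ℝ) (ζ : ℂ → ℂ) (cζ : ℂ) : Prop :=
  ∃ ζt : ℂ → ℂ, MemV Ω outerWeight (-β) ζt ∧
    ∀ᵐ z ∂(volume.restrict Ω), ζ z =
      (ψ ‖z‖ : ℂ) * singular (-μ) μ c z + cζ * ((ψ ‖z‖ : ℂ) * singular μ μ c z) + ζt z

/-- `Z = χ ρ^{iμ} φ + C_Z χ ρ^{-iμ} φ + Z̃` in `Ξ`, with `χ = 1 - ψ` and `Z̃` in the space of
exponent `β`. -/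
def InnerExpansion (ψ : ℝ → ℝ) (β μ c : ℝ) (Z : ℂ → ℂ) (CZ : ℂ) : Prop :=
  ∃ Zt : ℂ → ℂ, MemV Xi innerWeight β Zt ∧
    ∀ᵐ z ∂(volume.restrict Xi), Z z =
      ((1 - ψ ‖z‖ : ℝ) : ℂ) * singular μ μ c z
        + CZ * (((1 - ψ ‖z‖ : ℝ) : ℂ) * singular (-μ) μ c z) + Zt z

end SignChanging

end

noncomputable section

namespace SignChanging

/-!
Test the equation for `u` against `ρ u`, where `ρ` is a radial cut-off that varies only on the
annulus `t ≤ r ≤ 2t`, and take imaginary parts: since `σ |∇u|²` is real, what remains is that the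
flux `∫ k σ Im (ū r ∂_r u)` through the annulus vanishes, where `∇ρ = k (x, y)`. For
`u = A r^{-iμ} φ + B r^{iμ} φ` alone this flux, computed in polar coordinates, equals
`± (|B|² - |A|²) μ ∫ σ φ²` for every `t`. The contribution of the remainder tends to zero when the
annulus shrinks to the corner (outer problem) or moves to infinity (inner problem), so `|A| = |B|`.
-/

/-! ### Weak derivatives -/

section WeakDerivatives

variable {Ω U : Set ℂ} {e : ℂ} {v v' g g' f : ℂ → ℂ} {ρ : ℂ → ℝ}

theorem IsTest.mono (hf : IsTest U f) (h : U ⊆ Ω) : IsTest Ω f :=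
  ⟨hf.1, hf.2.1, hf.2.2.trans h⟩

theorem IsTest.fderiv_apply (hf : IsTest Ω f) (e : ℂ) : IsTest Ω (fun z => fderiv ℝ f z e) :=
  ⟨(hf.1.fderiv_right (by simp)).clm_apply contDiff_const, hf.2.1.fderiv_apply ℝ e,
    (tsupport_fderiv_apply_subset ℝ e).trans hf.2.2⟩

theorem IsTest.ofReal_mul (hf : IsTest Ω f) (hρ : ContDiff ℝ ∞ ρ) :
    IsTest Ω (fun z => (ρ z : ℂ) * f z) :=
  ⟨(Complex.ofRealCLM.contDiff.comp hρ).mul hf.1, hf.2.1.mul_left,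
    (tsupport_mul_subset_right (f := fun z => (ρ z : ℂ))).trans hf.2.2⟩

theorem IsTest.eq_zero_of_notMem (hf : IsTest Ω f) {z : ℂ} (hz : z ∉ Ω) : f z = 0 :=
  image_eq_zero_of_notMem_tsupport fun h => hz (hf.2.2 h)

theorem IsTest.setIntegral_mul (hf : IsTest Ω f) (v : ℂ → ℂ) :
    ∫ z in Ω, v z * f z = ∫ z, v z * f z :=
  setIntegral_eq_integral_of_forall_compl_eq_zero fun z hz => by
    rw [hf.eq_zero_of_notMem hz, mul_zero]

theorem IsTest.integrable_mul (hf : IsTest Ω f) (hv : LocallyIntegrableOn v Ω) :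
    Integrable (fun z => v z * f z) := by
  have h := (hv.integrableOn_compact_subset hf.2.2 hf.2.1).mul_continuousOn
    hf.1.continuous.continuousOn hf.2.1
  refine (integrableOn_iff_integrable_of_support_subset fun z hz => ?_).1 h
  exact subset_tsupport f (right_ne_zero_of_mul hz)

theorem fderiv_ofReal_mul {z : ℂ} (hρ : DifferentiableAt ℝ ρ z) (hf : DifferentiableAt ℝ f z)
    (e : ℂ) :
    fderiv ℝ (fun z => (ρ z : ℂ) * f z) z e =
      ρ z * fderiv ℝ f z e + (fderiv ℝ ρ z e : ℝ) * f z := by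
  have h : HasFDerivAt (fun z => (ρ z : ℂ) * f z) _ z :=
    (Complex.ofRealCLM.hasFDerivAt.comp z hρ.hasFDerivAt).mul hf.hasFDerivAt
  rw [h.fderiv]
  simp [mul_comm]

/-- `g` is the weak derivative of `v` in `Ω` in the direction `e`. Since test functions vanish
outside `Ω`, the integrals may be taken over the whole plane. -/
def HasWeakDeriv (Ω : Set ℂ) (e : ℂ) (v g : ℂ → ℂ) : Prop :=
  LocallyIntegrableOn v Ω ∧ LocallyIntegrableOn g Ω ∧
  ∀ f : ℂ → ℂ, IsTest Ω f → ∫ z, v z * fderiv ℝ f z e = -∫ z, g z * f z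

theorem isWeakGrad_iff {G : ℂ → ℂ × ℂ} :
    IsWeakGrad Ω v G ↔ HasWeakDeriv Ω 1 v (fun z => (G z).1) ∧
      HasWeakDeriv Ω Complex.I v (fun z => (G z).2) := by
  have hint (f : ℂ → ℂ) (hf : IsTest Ω f) (e : ℂ) (g : ℂ → ℂ) :
      (∫ z in Ω, v z * fderiv ℝ f z e = -∫ z in Ω, g z * f z) ↔
        ∫ z, v z * fderiv ℝ f z e = -∫ z, g z * f z := by
    rw [hf.setIntegral_mul, (hf.fderiv_apply e).setIntegral_mul]
  constructor
  · rintro ⟨hv, hG₁, hG₂, h⟩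
    exact ⟨⟨hv, hG₁, fun f hf => (hint f hf _ _).1 (h f hf).1⟩,
      ⟨hv, hG₂, fun f hf => (hint f hf _ _).1 (h f hf).2⟩⟩
  · rintro ⟨⟨hv, hG₁, h₁⟩, ⟨-, hG₂, h₂⟩⟩
    exact ⟨hv, hG₁, hG₂, fun f hf => ⟨(hint f hf _ _).2 (h₁ f hf), (hint f hf _ _).2 (h₂ f hf)⟩⟩

theorem HasWeakDeriv.mono (h : HasWeakDeriv Ω e v g) (hU : U ⊆ Ω) : HasWeakDeriv U e v g :=
  ⟨h.1.mono_set hU, h.2.1.mono_set hU, fun f hf => h.2.2 f (hf.mono hU)⟩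

theorem HasWeakDeriv.add (h : HasWeakDeriv Ω e v g) (h' : HasWeakDeriv Ω e v' g') :
    HasWeakDeriv Ω e (fun z => v z + v' z) (fun z => g z + g' z) := by
  refine ⟨h.1.add h'.1, h.2.1.add h'.2.1, fun f hf => ?_⟩
  simp only [add_mul]
  rw [integral_add ((hf.fderiv_apply e).integrable_mul h.1)
      ((hf.fderiv_apply e).integrable_mul h'.1),
    integral_add (hf.integrable_mul h.2.1) (hf.integrable_mul h'.2.1), h.2.2 f hf, h'.2.2 f hf,
    neg_add]

theorem HasWeakDeriv.ofReal_mul (hΩ : IsOpen Ω) (h : HasWeakDeriv Ω e v g)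
    (hρ : ContDiff ℝ ∞ ρ) :
    HasWeakDeriv Ω e (fun z => ρ z * v z) (fun z => ρ z * g z + (fderiv ℝ ρ z e : ℝ) * v z) := by
  have hρc : Continuous (fun z => (ρ z : ℂ)) := Complex.continuous_ofReal.comp hρ.continuous
  have hρc' : Continuous (fun z => ((fderiv ℝ ρ z e : ℝ) : ℂ)) :=
    Complex.continuous_ofReal.comp ((hρ.continuous_fderiv (by simp)).clm_apply continuous_const)
  have hρv := h.1.continuousOn_mul hρc.continuousOn hΩ.isLocallyClosed
  have hρg := h.2.1.continuousOn_mul hρc.continuousOn hΩ.isLocallyClosed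
  have hρ'v := h.1.continuousOn_mul hρc'.continuousOn hΩ.isLocallyClosed
  refine ⟨hρv, hρg.add hρ'v, fun f hf => ?_⟩
  have key := h.2.2 _ (hf.ofReal_mul hρ)
  have hleft : ∫ z, v z * fderiv ℝ (fun z => (ρ z : ℂ) * f z) z e =
      (∫ z, ρ z * v z * fderiv ℝ f z e) + ∫ z, (fderiv ℝ ρ z e : ℝ) * v z * f z := by
    rw [← integral_add ((hf.fderiv_apply e).integrable_mul hρv) (hf.integrable_mul hρ'v)]
    refine integral_congr_ae (.of_forall fun z => ?_)
    simp only
    rw [fderiv_ofReal_mul (hρ.differentiable (by simp) z) (hf.1.differentiable (by simp) z)]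
    ring
  have hright : ∫ z, (ρ z * g z + (fderiv ℝ ρ z e : ℝ) * v z) * f z =
      (∫ z, g z * (ρ z * f z)) + ∫ z, (fderiv ℝ ρ z e : ℝ) * v z * f z := by
    rw [← integral_add ((hf.ofReal_mul hρ).integrable_mul h.2.1) (hf.integrable_mul hρ'v)]
    refine integral_congr_ae (.of_forall fun z => ?_)
    simp only
    ring
  rw [hright, neg_add, ← key, hleft]
  ring

theorem hasWeakDeriv_of_contDiffOn (hU : IsOpen U) (hv : ContDiffOn ℝ 1 v U) (e : ℂ) :
    HasWeakDeriv U e v (fun z => fderiv ℝ v z e) := by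
  have lv : LocallyIntegrableOn v U := hv.continuousOn.locallyIntegrableOn hU.measurableSet
  have lv' : LocallyIntegrableOn (fun z => fderiv ℝ v z e) U :=
    ((hv.continuousOn_fderiv_of_isOpen hU le_rfl).clm_apply
      continuousOn_const).locallyIntegrableOn hU.measurableSet
  exact ⟨lv, lv', fun f hf => integral_mul_fderiv_eq_neg_fderiv_mul_of_integrable
    (hf.integrable_mul lv') ((hf.fderiv_apply e).integrable_mul lv) (hf.integrable_mul lv)
    (fun z hz => (hv.contDiffAt (hU.mem_nhds (hf.2.2 hz))).differentiableAt (by simp))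
    (fun z _ => hf.1.differentiable (by simp) z)⟩

theorem HasWeakDeriv.ae_unique (hU : IsOpen U) (h : HasWeakDeriv U e v g)
    (h' : HasWeakDeriv U e v' g') (hv : ∀ᵐ z, z ∈ U → v z = v' z) :
    ∀ᵐ z, z ∈ U → g z = g' z := by
  have hzero : ∀ᵐ z, z ∈ U → g z - g' z = 0 := by
    refine hU.ae_eq_zero_of_integral_contDiff_smul_eq_zero (h.2.1.sub h'.2.1)
      fun f hf hfc hfs => ?_
    have hF : IsTest U (fun z => (f z : ℂ)) :=
      ⟨Complex.ofRealCLM.contDiff.comp hf, hfc.comp_left (g := fun x : ℝ => (x : ℂ)) (by simp),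
        (tsupport_comp_subset (g := fun x : ℝ => (x : ℂ)) (by simp) f).trans hfs⟩
    have hvv' : ∫ z, v z * fderiv ℝ (fun z => (f z : ℂ)) z e =
        ∫ z, v' z * fderiv ℝ (fun z => (f z : ℂ)) z e := by
      refine integral_congr_ae (hv.mono fun z hz => ?_)
      by_cases hzU : z ∈ U
      · simp only [hz hzU]
      · simp only [(hF.fderiv_apply e).eq_zero_of_notMem hzU, mul_zero]
    calc ∫ z, f z • (g z - g' z) = ∫ z, (g z * f z - g' z * f z) :=
          integral_congr_ae (.of_forall fun z => by simp only [Complex.real_smul]; ring)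
      _ = (∫ z, g z * f z) - ∫ z, g' z * f z :=
          integral_sub (hF.integrable_mul h.2.1) (hF.integrable_mul h'.2.1)
      _ = 0 := by
          rw [h.2.2 _ hF, h'.2.2 _ hF] at hvv'
          rw [neg_injective hvv', sub_self]
  exact hzero.mono fun z hz hzU => sub_eq_zero.1 (hz hzU)

end WeakDerivatives

/-! ### Weighted spaces -/

section WeightedSpaces

variable {Ω : Set ℂ} {w : ℂ → ℝ} {β β' C N : ℝ} {u v f : ℂ → ℂ} {G H : ℂ → ℂ × ℂ}
  {ρ σ : ℂ → ℝ} {z : ℂ}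

/-- The density of the squared weighted norm, `G` standing for the gradient of `v`. -/
def normDensity (w : ℂ → ℝ) (β : ℝ) (v : ℂ → ℂ) (G : ℂ → ℂ × ℂ) (z : ℂ) : ℝ :=
  w z ^ (2 * (β - 1)) * ‖v z‖ ^ 2 + w z ^ (2 * β) * (‖(G z).1‖ ^ 2 + ‖(G z).2‖ ^ 2)

theorem normDensity_nonneg (hw : 0 < w z) (β : ℝ) (v : ℂ → ℂ) (G : ℂ → ℂ × ℂ) :
    0 ≤ normDensity w β v G z := by
  have hv := Real.rpow_nonneg hw.le (2 * (β - 1))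
  have hG := Real.rpow_nonneg hw.le (2 * β)
  unfold normDensity
  positivity

theorem normDensity_eq_rpow_mul (hw : 0 < w z) (β β' : ℝ) (v : ℂ → ℂ) (G : ℂ → ℂ × ℂ) :
    normDensity w β' v G z = w z ^ (2 * (β' - β)) * normDensity w β v G z := by
  have hv : w z ^ (2 * (β' - 1)) = w z ^ (2 * (β' - β)) * w z ^ (2 * (β - 1)) := by
    rw [← Real.rpow_add hw]
    ring_nf
  have hG : w z ^ (2 * β') = w z ^ (2 * (β' - β)) * w z ^ (2 * β) := by
    rw [← Real.rpow_add hw]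
    ring_nf
  rw [normDensity, normDensity, hv, hG]
  ring

theorem normDensity_le_two_mul (hw : 0 < w z) (β : ℝ) (v f : ℂ → ℂ) (G F : ℂ → ℂ × ℂ) :
    normDensity w β v G z ≤
      2 * normDensity w β (fun z => v z - f z) (fun z => G z - F z) z +
        2 * normDensity w β f F z := by
  have key (a b : ℂ) : ‖a‖ ^ 2 ≤ 2 * ‖a - b‖ ^ 2 + 2 * ‖b‖ ^ 2 := by
    have h : ‖a‖ ≤ ‖a - b‖ + ‖b‖ := by simpa using norm_add_le (a - b) b
    nlinarith [sq_nonneg (‖a - b‖ - ‖b‖), norm_nonneg a, norm_nonneg b, norm_nonneg (a - b)]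
  have hv := mul_le_mul_of_nonneg_left (key (v z) (f z)) (Real.rpow_nonneg hw.le (2 * (β - 1)))
  have hG₁ := mul_le_mul_of_nonneg_left (key (G z).1 (F z).1) (Real.rpow_nonneg hw.le (2 * β))
  have hG₂ := mul_le_mul_of_nonneg_left (key (G z).2 (F z).2) (Real.rpow_nonneg hw.le (2 * β))
  simp only [normDensity, Prod.fst_sub, Prod.snd_sub]
  linarith

/-- `v`, with weak gradient `G`, is a limit of test functions in the weighted norm: the relation
underlying `MemV`, with the gradient made explicit. -/
def MemVWith (Ω : Set ℂ) (w : ℂ → ℝ) (β : ℝ) (v : ℂ → ℂ) (G : ℂ → ℂ × ℂ) : Prop :=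
  IsWeakGrad Ω v G ∧ ∃ f : ℕ → ℂ → ℂ, (∀ n, IsTest Ω (f n)) ∧
    Tendsto (fun n => weightedNormSq Ω w β (fun z => v z - f n z) (fun z => G z - grad (f n) z))
      atTop (𝓝 0)

theorem memV_iff : MemV Ω w β v ↔ ∃ G, MemVWith Ω w β v G := Iff.rfl

theorem aestronglyMeasurable_normDensity (hw : Measurable w) (β : ℝ)
    (hv : AEStronglyMeasurable v (volume.restrict Ω))
    (hG₁ : AEStronglyMeasurable (fun z => (G z).1) (volume.restrict Ω))
    (hG₂ : AEStronglyMeasurable (fun z => (G z).2) (volume.restrict Ω)) :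
    AEStronglyMeasurable (normDensity w β v G) (volume.restrict Ω) := by
  have hp (p : ℝ) : AEStronglyMeasurable (fun z => w z ^ p) (volume.restrict Ω) :=
    (hw.pow_const p).aestronglyMeasurable
  exact ((hp _).mul (hv.norm.pow 2)).add ((hp _).mul ((hG₁.norm.pow 2).add (hG₂.norm.pow 2)))

theorem IsTest.integrable_normDensity (hw : Continuous w) (hpos : ∀ z ∈ Ω, 0 < w z) (β : ℝ)
    (hf : IsTest Ω f) : Integrable (normDensity w β f (grad f)) := by
  have hp (p : ℝ) : ContinuousOn (fun z => w z ^ p) (tsupport f) :=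
    hw.continuousOn.rpow_const fun z hz => .inl (hpos z (hf.2.2 hz)).ne'
  have hc : ContinuousOn (normDensity w β f (grad f)) (tsupport f) :=
    ((hp _).mul (hf.1.continuous.norm.pow 2).continuousOn).add
      ((hp _).mul (((hf.fderiv_apply 1).1.continuous.norm.pow 2).add
        ((hf.fderiv_apply Complex.I).1.continuous.norm.pow 2)).continuousOn)
  refine (integrableOn_iff_integrable_of_support_subset fun z hz => ?_).1
    (hc.integrableOn_compact hf.2.1)
  by_contra h
  have hfz : f z = 0 := image_eq_zero_of_notMem_tsupport h
  have hdfz : fderiv ℝ f z = 0 :=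
    image_eq_zero_of_notMem_tsupport fun h' => h (tsupport_fderiv_subset ℝ h')
  exact hz (by simp [normDensity, grad, hfz, hdfz])

theorem MemVWith.integrableOn (hΩ : IsOpen Ω) (hw : Continuous w) (hpos : ∀ z ∈ Ω, 0 < w z)
    (h : MemVWith Ω w β v G) : IntegrableOn (normDensity w β v G) Ω := by
  obtain ⟨⟨lv, lG₁, lG₂, -⟩, f, hf, hlim⟩ := h
  obtain ⟨n, hn⟩ := (hlim.eventually (gt_mem_nhds ENNReal.zero_lt_top)).exists
  have mf {g : ℂ → ℂ} (hg : IsTest Ω g) : AEStronglyMeasurable g (volume.restrict Ω) :=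
    hg.1.continuous.aestronglyMeasurable
  have hdiff : IntegrableOn
      (normDensity w β (fun z => v z - f n z) (fun z => G z - grad (f n) z)) Ω := by
    refine ⟨aestronglyMeasurable_normDensity hw.measurable β
      (lv.aestronglyMeasurable.sub (mf (hf n)))
      (lG₁.aestronglyMeasurable.sub (mf ((hf n).fderiv_apply 1)))
      (lG₂.aestronglyMeasurable.sub (mf ((hf n).fderiv_apply Complex.I))), ?_⟩
    rw [hasFiniteIntegral_iff_ofReal]
    · exact hn
    · filter_upwards [ae_restrict_mem hΩ.measurableSet] with z hz
      exact normDensity_nonneg (hpos z hz) _ _ _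
  have htest := ((hf n).integrable_normDensity hw hpos β).integrableOn (s := Ω)
  refine ((hdiff.const_mul 2).add (htest.const_mul 2)).mono'
    (aestronglyMeasurable_normDensity hw.measurable β lv.aestronglyMeasurable
      lG₁.aestronglyMeasurable lG₂.aestronglyMeasurable) ?_
  filter_upwards [ae_restrict_mem hΩ.measurableSet] with z hz
  rw [Real.norm_of_nonneg (normDensity_nonneg (hpos z hz) _ _ _)]
  exact normDensity_le_two_mul (hpos z hz) _ _ _ _ _

/-- The gradient of `ρ v`, where `G` is the gradient of `v`. -/
def mulGrad (ρ : ℂ → ℝ) (v : ℂ → ℂ) (G : ℂ → ℂ × ℂ) (z : ℂ) : ℂ × ℂ :=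
  (ρ z * (G z).1 + (fderiv ℝ ρ z 1 : ℝ) * v z,
    ρ z * (G z).2 + (fderiv ℝ ρ z Complex.I : ℝ) * v z)

theorem IsWeakGrad.ofReal_mul (hΩ : IsOpen Ω) (h : IsWeakGrad Ω v G) (hρ : ContDiff ℝ ∞ ρ) :
    IsWeakGrad Ω (fun z => ρ z * v z) (mulGrad ρ v G) := by
  rw [isWeakGrad_iff] at h ⊢
  exact ⟨h.1.ofReal_mul hΩ hρ, h.2.ofReal_mul hΩ hρ⟩

theorem IsTest.grad_ofReal_mul (hf : IsTest Ω f) (hρ : ContDiff ℝ ∞ ρ) (z : ℂ) :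
    grad (fun z => (ρ z : ℂ) * f z) z = mulGrad ρ f (grad f) z := by
  have hρz : DifferentiableAt ℝ ρ z := hρ.differentiable (by simp) z
  have hfz : DifferentiableAt ℝ f z := hf.1.differentiable (by simp) z
  simp only [grad, mulGrad, fderiv_ofReal_mul hρz hfz]

theorem normDensity_mulGrad_le (hw : 0 < w z) (β : ℝ) (hρ : ρ z ^ 2 ≤ 1)
    (hN : (fderiv ℝ ρ z 1 ^ 2 + fderiv ℝ ρ z Complex.I ^ 2) * w z ^ 2 ≤ N) (v : ℂ → ℂ)
    (G : ℂ → ℂ × ℂ) :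
    normDensity w β (fun z => ρ z * v z) (mulGrad ρ v G) z ≤
      2 * (1 + N) * normDensity w β v G z := by
  have key (b : ℝ) (x y : ℂ) : ‖(ρ z : ℂ) * x + b * y‖ ^ 2 ≤
      2 * ‖x‖ ^ 2 + 2 * (b ^ 2 * ‖y‖ ^ 2) := by
    calc ‖(ρ z : ℂ) * x + b * y‖ ^ 2 ≤ (|ρ z| * ‖x‖ + |b| * ‖y‖) ^ 2 := by
          gcongr
          exact (norm_add_le _ _).trans_eq (by simp)
      _ ≤ 2 * (|ρ z| * ‖x‖) ^ 2 + 2 * (|b| * ‖y‖) ^ 2 := by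
          nlinarith [sq_nonneg (|ρ z| * ‖x‖ - |b| * ‖y‖)]
      _ ≤ 2 * (1 * ‖x‖ ^ 2) + 2 * (b ^ 2 * ‖y‖ ^ 2) := by
          simp only [mul_pow, sq_abs]
          gcongr
      _ = 2 * ‖x‖ ^ 2 + 2 * (b ^ 2 * ‖y‖ ^ 2) := by rw [one_mul]
  have hp : w z ^ (2 * β) = w z ^ (2 * (β - 1)) * w z ^ 2 := by
    rw [← Real.rpow_natCast, ← Real.rpow_add hw]
    ring_nf
  have hp₀ := Real.rpow_nonneg hw.le (2 * (β - 1))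
  have hp₁ := Real.rpow_nonneg hw.le (2 * β)
  have hN₀ : 0 ≤ N := le_trans (by positivity) hN
  have hgrad := mul_le_mul_of_nonneg_left
    (add_le_add (key (fderiv ℝ ρ z 1) (G z).1 (v z)) (key (fderiv ℝ ρ z Complex.I) (G z).2 (v z)))
    hp₁
  have hslope := mul_le_mul_of_nonneg_left (mul_le_mul_of_nonneg_right hN (sq_nonneg ‖v z‖)) hp₀
  have hvalue := mul_le_mul_of_nonneg_left (mul_le_mul_of_nonneg_right hρ (sq_nonneg ‖v z‖)) hp₀
  have hG : 0 ≤ N * (w z ^ (2 * β) * (‖(G z).1‖ ^ 2 + ‖(G z).2‖ ^ 2)) := by positivity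
  have hv : 0 ≤ w z ^ (2 * (β - 1)) * ‖v z‖ ^ 2 := by positivity
  simp only [normDensity, mulGrad, norm_mul, Complex.norm_real, Real.norm_eq_abs, mul_pow, sq_abs]
  rw [hp] at hgrad hG ⊢
  linarith

theorem MemVWith.ofReal_mul (hΩ : IsOpen Ω) (hpos : ∀ z ∈ Ω, 0 < w z) (hρ : ContDiff ℝ ∞ ρ)
    (hC : ∀ z ∈ Ω, ∀ (v : ℂ → ℂ) (G : ℂ → ℂ × ℂ),
      normDensity w β' (fun z => ρ z * v z) (mulGrad ρ v G) z ≤ C * normDensity w β v G z)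
    (h : MemVWith Ω w β v G) :
    MemVWith Ω w β' (fun z => ρ z * v z) (mulGrad ρ v G) := by
  obtain ⟨hG, f, hf, hlim⟩ := h
  refine ⟨hG.ofReal_mul hΩ hρ, fun n z => ρ z * f n z, fun n => (hf n).ofReal_mul hρ, ?_⟩
  have hlim' := ENNReal.Tendsto.const_mul hlim (.inr (ENNReal.ofReal_ne_top (r := C)))
  rw [mul_zero] at hlim'
  refine tendsto_of_tendsto_of_tendsto_of_le_of_le tendsto_const_nhds hlim'
    (fun _ => bot_le) fun n => ?_
  set d : ℂ → ℂ := fun z => v z - f n z with hd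
  set D : ℂ → ℂ × ℂ := fun z => G z - grad (f n) z with hD
  have hsub : weightedNormSq Ω w β' (fun z => ρ z * v z - ρ z * f n z)
      (fun z => mulGrad ρ v G z - grad (fun z => ρ z * f n z) z) =
      ∫⁻ z in Ω, ENNReal.ofReal (normDensity w β' (fun z => ρ z * d z) (mulGrad ρ d D) z) := by
    have hval (z : ℂ) : ρ z * v z - ρ z * f n z = ρ z * d z := by rw [hd]; ring
    have hgrad (z : ℂ) :
        mulGrad ρ v G z - grad (fun z => ρ z * f n z) z = mulGrad ρ d D z := by
      rw [(hf n).grad_ofReal_mul hρ, hd, hD]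
      ext <;> simp only [mulGrad, Prod.fst_sub, Prod.snd_sub] <;> ring
    simp only [hval, hgrad]
    rfl
  rw [hsub, weightedNormSq, ← lintegral_const_mul' _ _ ENNReal.ofReal_ne_top]
  refine setLIntegral_mono_ae' hΩ.measurableSet (.of_forall fun z hz => ?_)
  exact (ENNReal.ofReal_le_ofReal (hC z hz d D)).trans_eq
    (ENNReal.ofReal_mul' (normDensity_nonneg (hpos z hz) β d D))

theorem fderiv_eq_zero_of_eq_zero_of_nonneg (hρ : ∀ z, 0 ≤ ρ z) (hz : ρ z = 0) :
    fderiv ℝ ρ z = 0 :=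
  IsLocalMin.fderiv_eq_zero (.of_forall fun x => hz ▸ hρ x)

theorem MemVWith.ofReal_mul_of_weight_le (hΩ : IsOpen Ω) (hpos : ∀ z ∈ Ω, 0 < w z)
    (hρ : ContDiff ℝ ∞ ρ) (hρ01 : ∀ z, ρ z ∈ Set.Icc 0 1)
    (hN : ∀ z ∈ Ω, (fderiv ℝ ρ z 1 ^ 2 + fderiv ℝ ρ z Complex.I ^ 2) * w z ^ 2 ≤ N)
    (hC : ∀ z ∈ Ω, ρ z ≠ 0 → w z ^ (2 * (β' - β)) ≤ C)
    (h : MemVWith Ω w β v G) :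
    MemVWith Ω w β' (fun z => ρ z * v z) (mulGrad ρ v G) := by
  refine h.ofReal_mul (C := |C| * (2 * (1 + N))) hΩ hpos hρ fun z hz v G => ?_
  have hN₀ : 0 ≤ N := le_trans (by positivity) (hN z hz)
  have hnonneg := normDensity_nonneg (hpos z hz) β v G
  rcases eq_or_ne (ρ z) 0 with hρz | hρz
  · have hdρ := fderiv_eq_zero_of_eq_zero_of_nonneg (fun z => (hρ01 z).1) hρz
    have hzero : normDensity w β' (fun z => ρ z * v z) (mulGrad ρ v G) z = 0 := by
      simp [normDensity, mulGrad, hρz, hdρ]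
    rw [hzero]
    positivity
  · have hsq : ρ z ^ 2 ≤ 1 := pow_le_one₀ (hρ01 z).1 (hρ01 z).2
    rw [normDensity_eq_rpow_mul (hpos z hz) β β', mul_assoc]
    exact mul_le_mul ((hC z hz hρz).trans (le_abs_self C))
      (normDensity_mulGrad_le (hpos z hz) β hsq (hN z hz) v G)
      (normDensity_nonneg (hpos z hz) _ _ _) (abs_nonneg C)

theorem integrableOn_form (hΩ : IsOpen Ω) (hw : Continuous w) (hpos : ∀ z ∈ Ω, 0 < w z)
    (hu : MemVWith Ω w β u G) (hv : MemVWith Ω w (-β) v H) (hσ : Measurable σ) {S : ℝ}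
    (hS : ∀ z, |σ z| ≤ S) :
    IntegrableOn (fun z => (σ z : ℂ) *
      ((G z).1 * starRingEnd ℂ (H z).1 + (G z).2 * starRingEnd ℂ (H z).2)) Ω := by
  have hconj {g : ℂ → ℂ} (hg : LocallyIntegrableOn g Ω) :
      AEStronglyMeasurable (fun z => starRingEnd ℂ (g z)) (volume.restrict Ω) :=
    Complex.continuous_conj.comp_aestronglyMeasurable hg.aestronglyMeasurable
  refine (((hu.integrableOn hΩ hw hpos).add (hv.integrableOn hΩ hw hpos)).const_mul S).mono'
    ((Complex.measurable_ofReal.comp hσ).aestronglyMeasurable.mul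
      ((hu.1.2.1.aestronglyMeasurable.mul (hconj hv.1.2.1)).add
        (hu.1.2.2.1.aestronglyMeasurable.mul (hconj hv.1.2.2.1)))) ?_
  filter_upwards [ae_restrict_mem hΩ.measurableSet] with z hz
  have hwz := hpos z hz
  have young (a b : ℝ) : a * b ≤ w z ^ (2 * β) * a ^ 2 + w z ^ (2 * -β) * b ^ 2 := by
    have hsq (c : ℝ) : w z ^ (2 * c) = (w z ^ c) ^ 2 := by
      rw [← Real.rpow_mul_natCast hwz.le, Nat.cast_ofNat, mul_comm]
    have hinv : w z ^ β * w z ^ (-β) = 1 := by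
      rw [← Real.rpow_add hwz, add_neg_cancel, Real.rpow_zero]
    rw [hsq, hsq]
    calc a * b = (w z ^ β * a) * (w z ^ (-β) * b) := by linear_combination (-(a * b)) * hinv
      _ ≤ (w z ^ β) ^ 2 * a ^ 2 + (w z ^ (-β)) ^ 2 * b ^ 2 := by
        nlinarith [sq_nonneg (w z ^ β * a - w z ^ (-β) * b), sq_nonneg (w z ^ β * a),
          sq_nonneg (w z ^ (-β) * b)]
  rw [norm_mul, Complex.norm_real, Real.norm_eq_abs]
  refine mul_le_mul (hS z) ((norm_add_le _ _).trans ?_) (norm_nonneg _)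
    ((abs_nonneg _).trans (hS z))
  simp only [norm_mul, RCLike.norm_conj, Pi.add_apply, normDensity]
  have hu₀ := mul_nonneg (Real.rpow_nonneg hwz.le (2 * (β - 1))) (sq_nonneg ‖u z‖)
  have hv₀ := mul_nonneg (Real.rpow_nonneg hwz.le (2 * (-β - 1))) (sq_nonneg ‖v z‖)
  linarith [young ‖(G z).1‖ ‖(H z).1‖, young ‖(G z).2‖ ‖(H z).2‖]

end WeightedSpaces

/-! ### Polar coordinates -/

theorem ae_comp_arg {p : ℝ → Prop} (hp : ∀ᵐ θ, p θ) : ∀ᵐ z : ℂ, p z.arg := by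
  obtain ⟨s, hps, hs, hs₀⟩ := exists_measurable_superset_of_null hp
  have hnull : ∫⁻ z : ℂ, s.indicator 1 z.arg = 0 := by
    rw [← Complex.lintegral_comp_polarCoord_symm, polarCoord_target]
    have hsnd : ∀ᵐ q : ℝ × ℝ, q.2 ∉ s :=
      Measure.quasiMeasurePreserving_snd.ae (measure_eq_zero_iff_ae_notMem.1 hs₀)
    rw [lintegral_eq_zero_of_ae_eq_zero]
    filter_upwards [ae_restrict_mem (measurableSet_Ioi.prod measurableSet_Ioo),
      ae_restrict_of_ae hsnd] with q hq hqs
    have harg : (Complex.polarCoord.symm q).arg = q.2 :=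
      congrArg Prod.snd (Complex.polarCoord.right_inv hq)
    rw [harg, Set.indicator_of_notMem hqs, smul_zero, Pi.zero_apply]
  have hmeas : Measurable fun z : ℂ => s.indicator (1 : ℝ → ℝ≥0∞) z.arg :=
    (measurable_one.indicator hs).comp Complex.measurable_arg
  filter_upwards [(lintegral_eq_zero_iff hmeas).1 hnull] with z hz
  by_contra hpz
  have hzs : z.arg ∈ s := hps hpz
  simp [hzs] at hz

/-! ### Radial cut-off functions -/

section RadialCutoff

variable {g ψ : ℝ → ℝ} {t : ℝ} {z : ℂ}

/-- A smooth function with values in `[0, 1]` that is constant on each side of the transition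
interval `[1, 2]`, with different constants. Both `ψ` and `1 - ψ` are of this kind. -/
structure IsTransition (g : ℝ → ℝ) : Prop where
  contDiff : ContDiff ℝ ∞ g
  mem_Icc : ∀ r, g r ∈ Set.Icc (0 : ℝ) 1
  eq_of_le_one : ∀ r ≤ 1, g r = g 1
  eq_of_two_le : ∀ r, 2 ≤ r → g r = g 2
  ne : g 1 ≠ g 2

theorem IsCutoff.isTransition (hψ : IsCutoff ψ) : IsTransition ψ := by
  obtain ⟨hψ, h01, hone, hzero⟩ := hψ
  refine ⟨hψ, h01, fun r hr => ?_, fun r hr => ?_, ?_⟩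
  · rw [hone r hr, hone 1 le_rfl]
  · rw [hzero r hr, hzero 2 le_rfl]
  · rw [hone 1 le_rfl, hzero 2 le_rfl]
    exact one_ne_zero

theorem IsTransition.one_sub (hg : IsTransition g) : IsTransition (fun r => 1 - g r) where
  contDiff := contDiff_const.sub hg.contDiff
  mem_Icc r := ⟨sub_nonneg.2 (hg.mem_Icc r).2, sub_le_self 1 (hg.mem_Icc r).1⟩
  eq_of_le_one r hr := by rw [hg.eq_of_le_one r hr]
  eq_of_two_le r hr := by rw [hg.eq_of_two_le r hr]
  ne h := hg.ne (sub_right_injective h)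

theorem IsTransition.deriv_eq_zero (hg : IsTransition g) {r : ℝ} (hr : r ∉ Set.Icc (1 : ℝ) 2) :
    deriv g r = 0 := by
  rw [Set.mem_Icc, not_and_or, not_le, not_le] at hr
  rcases hr with hr | hr
  · have h : g =ᶠ[𝓝 r] fun _ => g 1 := by
      filter_upwards [gt_mem_nhds hr] with x hx using hg.eq_of_le_one x hx.le
    rw [h.deriv_eq, deriv_const]
  · have h : g =ᶠ[𝓝 r] fun _ => g 2 := by
      filter_upwards [lt_mem_nhds hr] with x hx using hg.eq_of_two_le x hx.le
    rw [h.deriv_eq, deriv_const]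

theorem IsTransition.exists_abs_deriv_le (hg : IsTransition g) : ∃ M, ∀ r, |deriv g r| ≤ M := by
  have hc : HasCompactSupport (deriv g) :=
    HasCompactSupport.intro isCompact_Icc fun _ hr => hg.deriv_eq_zero hr
  exact hc.exists_bound_of_continuous (hg.contDiff.continuous_deriv (by simp))

/-- The function `z ↦ g (r / t)`. -/
def radialCutoff (g : ℝ → ℝ) (t : ℝ) (z : ℂ) : ℝ := g (‖z‖ / t)

/-- The factor `k` in `∇ (g (r / t)) = k (x, y)`. -/
def cutoffSlope (g : ℝ → ℝ) (t : ℝ) (z : ℂ) : ℝ := deriv g (‖z‖ / t) / (t * ‖z‖)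

/-- The annulus `t ≤ r ≤ 2 t`, outside which `radialCutoff g t` is locally constant. -/
def annulus (t : ℝ) : Set ℂ := {z | t ≤ ‖z‖ ∧ ‖z‖ ≤ 2 * t}

theorem IsTransition.radialCutoff_eventuallyEq (hg : IsTransition g) (ht : 0 < t) :
    radialCutoff g t =ᶠ[𝓝 0] fun _ => g 1 := by
  filter_upwards [Metric.ball_mem_nhds (0 : ℂ) ht] with z hz
  exact hg.eq_of_le_one _ ((div_le_one ht).2 (mem_ball_zero_iff.1 hz).le)

theorem IsTransition.contDiff_radialCutoff (hg : IsTransition g) (ht : 0 < t) :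
    ContDiff ℝ ∞ (radialCutoff g t) := by
  refine contDiff_iff_contDiffAt.2 fun z => ?_
  rcases eq_or_ne z 0 with rfl | hz
  · exact contDiffAt_const.congr_of_eventuallyEq (hg.radialCutoff_eventuallyEq ht)
  · exact hg.contDiff.contDiffAt.comp z ((contDiffAt_norm ℝ hz).div_const t)

theorem IsTransition.fderiv_radialCutoff (hg : IsTransition g) (ht : 0 < t) (z e : ℂ) :
    fderiv ℝ (radialCutoff g t) z e = cutoffSlope g t z * (z.re * e.re + z.im * e.im) := by
  rcases eq_or_ne z 0 with rfl | hz
  · simp [(hg.radialCutoff_eventuallyEq ht).fderiv_eq]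
  have hnorm : HasFDerivAt (fun z : ℂ => ‖z‖ / t) ((‖z‖⁻¹ / t) • innerSL ℝ z) z := by
    have h := (hasStrictFDerivAt_norm_sq z).hasFDerivAt.sqrt (by simpa using hz)
    simp only [Real.sqrt_sq (norm_nonneg _)] at h
    convert! h.mul_const t⁻¹ using 1
    ext e
    simp
    ring
  have h : HasFDerivAt (radialCutoff g t) _ z :=
    (hg.contDiff.differentiable (by simp) (‖z‖ / t)).hasDerivAt.comp_hasFDerivAt z hnorm
  rw [h.fderiv]
  simp [cutoffSlope, Complex.inner]
  ring

theorem IsTransition.cutoffSlope_eq_zero (hg : IsTransition g) (ht : 0 < t) (hz : z ∉ annulus t) :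
    cutoffSlope g t z = 0 := by
  rw [cutoffSlope, hg.deriv_eq_zero, zero_div]
  exact fun h => hz ⟨(one_le_div ht).1 h.1, (div_le_iff₀ ht).1 h.2⟩

theorem abs_cutoffSlope_le {M : ℝ} (hM : ∀ r, |deriv g r| ≤ M) (ht : 0 < t)
    (hz : z ∈ annulus t) : |cutoffSlope g t z| ≤ M / t ^ 2 := by
  rw [cutoffSlope, abs_div, abs_of_pos (mul_pos ht (ht.trans_le hz.1)), pow_two]
  gcongr
  · exact (abs_nonneg _).trans (hM 0)
  · exact hM _
  · exact hz.1

theorem IsTransition.sq_fderiv_radialCutoff_mul_le (hg : IsTransition g) {M m w : ℝ}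
    (hM : ∀ r, |deriv g r| ≤ M) (ht : 0 < t) (hw : 0 ≤ w) (hwm : z ∈ annulus t → w ≤ m * t) :
    (fderiv ℝ (radialCutoff g t) z 1 ^ 2 + fderiv ℝ (radialCutoff g t) z Complex.I ^ 2) * w ^ 2 ≤
      (2 * M * m) ^ 2 := by
  have hgrad : fderiv ℝ (radialCutoff g t) z 1 ^ 2 +
      fderiv ℝ (radialCutoff g t) z Complex.I ^ 2 = (cutoffSlope g t z * ‖z‖) ^ 2 := by
    rw [hg.fderiv_radialCutoff ht, hg.fderiv_radialCutoff ht, mul_pow _ ‖z‖, Complex.sq_norm,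
      Complex.normSq_apply]
    simp only [Complex.one_re, Complex.one_im, Complex.I_re, Complex.I_im]
    ring
  rw [hgrad, ← mul_pow]
  by_cases hz : z ∈ annulus t
  · rw [sq_le_sq, abs_mul, abs_mul, abs_norm, abs_of_nonneg hw]
    have hM₀ : 0 ≤ M := (abs_nonneg _).trans (hM 0)
    calc |cutoffSlope g t z| * ‖z‖ * w ≤ M / t ^ 2 * (2 * t) * (m * t) := by
          gcongr
          · exact abs_cutoffSlope_le hM ht hz
          · exact hz.2
          · exact hwm hz
      _ = 2 * M * m := by field_simp
      _ ≤ |2 * M * m| := le_abs_self _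
  · rw [hg.cutoffSlope_eq_zero ht hz, zero_mul, zero_mul, zero_pow two_ne_zero]
    exact sq_nonneg _

theorem IsTransition.integral_deriv (hg : IsTransition g) (ht : 0 < t) :
    ∫ r in Set.Ioi (0 : ℝ), deriv g (r / t) / t = g 2 - g 1 := by
  have hderiv (r : ℝ) : HasDerivAt (fun r => g (r / t)) (deriv g (r / t) / t) r := by
    have h := (hg.contDiff.differentiable (by simp) (r / t)).hasDerivAt.comp r
      ((hasDerivAt_id r).div_const t)
    simpa [div_eq_mul_inv, Function.comp_def] using h
  have hcont : Continuous fun r => deriv g (r / t) / t :=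
    ((hg.contDiff.continuous_deriv (by simp)).comp (continuous_id.div_const t)).div_const t
  have htrunc : ∫ r in Set.Ioi (0 : ℝ), deriv g (r / t) / t =
      ∫ r in Set.Ioc (0 : ℝ) (2 * t), deriv g (r / t) / t := by
    refine setIntegral_eq_of_subset_of_forall_sdiff_eq_zero measurableSet_Ioi
      Set.Ioc_subset_Ioi_self fun r hr => ?_
    rw [hg.deriv_eq_zero fun h => hr.2 ⟨hr.1, (div_le_iff₀ ht).1 h.2⟩, zero_div]
  rw [htrunc, ← intervalIntegral.integral_of_le (by positivity),
    intervalIntegral.integral_eq_sub_of_hasDerivAt (fun r _ => hderiv r)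
      (hcont.intervalIntegrable _ _),
    mul_div_cancel_right₀ _ ht.ne', zero_div, hg.eq_of_le_one 0 zero_le_one]

theorem IsTransition.integral_cutoffSlope_mul (hg : IsTransition g) (ht : 0 < t) (f : ℝ → ℝ) :
    ∫ z : ℂ, cutoffSlope g t z * f z.arg =
      (g 2 - g 1) * ∫ θ in Set.Ioo (-Real.pi) Real.pi, f θ := by
  have hpolar : ∀ p ∈ Set.Ioi (0 : ℝ) ×ˢ Set.Ioo (-Real.pi) Real.pi,
      p.1 • (cutoffSlope g t (Complex.polarCoord.symm p) * f (Complex.polarCoord.symm p).arg) =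
        deriv g (p.1 / t) / t * f p.2 := by
    intro p hp
    have hnorm : ‖Complex.polarCoord.symm p‖ = p.1 := by
      rw [Complex.norm_polarCoord_symm, abs_of_pos hp.1]
    have harg : (Complex.polarCoord.symm p).arg = p.2 :=
      congrArg Prod.snd (Complex.polarCoord.right_inv hp)
    have hr : p.1 ≠ 0 := hp.1.ne'
    rw [harg, cutoffSlope, hnorm, smul_eq_mul]
    field_simp
  rw [← Complex.integral_comp_polarCoord_symm, polarCoord_target,
    setIntegral_congr_fun (measurableSet_Ioi.prod measurableSet_Ioo) hpolar,
    Measure.volume_eq_prod, setIntegral_prod_mul (fun r => deriv g (r / t) / t) f,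
    hg.integral_deriv ht]

end RadialCutoff

/-! ### Angular waves -/

section AngularWave

variable {L : ℝ} {φ : ℝ → ℝ} {z : ℂ}

/-- The function `r^{i s} φ(θ)`, for an arbitrary angular profile `φ`. -/
def angularWave (s : ℝ) (φ : ℝ → ℝ) (z : ℂ) : ℂ := (‖z‖ : ℂ) ^ (Complex.I * s) * φ z.arg

theorem norm_angularWave (s : ℝ) (φ : ℝ → ℝ) (hz : z ≠ 0) : ‖angularWave s φ z‖ = |φ z.arg| := by
  rw [angularWave, norm_mul, Complex.norm_cpow_eq_rpow_re_of_pos (norm_pos_iff.2 hz)]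
  simp

theorem angularWave_neg (s : ℝ) (φ : ℝ → ℝ) (z : ℂ) :
    angularWave (-s) φ z = starRingEnd ℂ (angularWave s φ z) := by
  have harg : (‖z‖ : ℂ).arg ≠ Real.pi := by
    rw [Complex.arg_ofReal_of_nonneg (norm_nonneg z)]
    exact Real.pi_ne_zero.symm
  have hconj : Complex.I * ((-s : ℝ) : ℂ) = starRingEnd ℂ (Complex.I * s) := by simp
  rw [angularWave, hconj, Complex.cpow_conj _ _ harg, Complex.conj_ofReal, angularWave, map_mul,
    Complex.conj_ofReal]

/-- In the coordinate `log z = log r + iθ` the factors of `r^{i s} φ(θ)` separate. -/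
def logWave (s : ℝ) (φ : ℝ → ℝ) (x : ℂ) : ℂ := Complex.exp (Complex.I * s * x.re) * φ x.im

theorem angularWave_eq_logWave (s : ℝ) (φ : ℝ → ℝ) (hz : z ≠ 0) :
    angularWave s φ z = logWave s φ (Complex.log z) := by
  have hnorm : (‖z‖ : ℂ) ≠ 0 := by simpa using hz
  rw [angularWave, logWave, Complex.cpow_def_of_ne_zero hnorm, Complex.log_re, Complex.log_im,
    ← Complex.ofReal_log (norm_nonneg z), mul_comm (Complex.I * (s : ℂ))]

theorem angularWave_eventuallyEq (s : ℝ) (φ : ℝ → ℝ) (hz : z ≠ 0) :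
    angularWave s φ =ᶠ[𝓝 z] logWave s φ ∘ Complex.log := by
  filter_upwards [isOpen_ne.mem_nhds hz] with x hx using angularWave_eq_logWave s φ hx

theorem contDiffAt_angularWave (s : ℝ) (hz : z ∈ Complex.slitPlane)
    (hφ : ContDiffAt ℝ 1 φ z.arg) : ContDiffAt ℝ 1 (angularWave s φ) z := by
  rw [← Complex.log_im] at hφ
  have hexp : ContDiff ℝ 1 fun x : ℂ => Complex.exp (Complex.I * s * x.re) :=
    (contDiff_const.mul (Complex.ofRealCLM.comp Complex.reCLM).contDiff).cexp
  have hang : ContDiffAt ℝ 1 (fun x : ℂ => (φ x.im : ℂ)) (Complex.log z) :=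
    Complex.ofRealCLM.contDiff.contDiffAt.comp _
      (ContDiffAt.comp (Complex.log z) hφ Complex.imCLM.contDiff.contDiffAt)
  exact ((hexp.contDiffAt.mul hang).comp z
    ((Complex.contDiffAt_log hz).restrict_scalars ℝ)).congr_of_eventuallyEq
      (angularWave_eventuallyEq s φ (Complex.slitPlane_ne_zero hz))

theorem fderiv_angularWave_self (s : ℝ) (hz : z ∈ Complex.slitPlane)
    (hφ : ContDiffAt ℝ 1 φ z.arg) :
    fderiv ℝ (angularWave s φ) z z = Complex.I * s * angularWave s φ z := by
  rw [← Complex.log_im] at hφ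
  have hz₀ : z ≠ 0 := Complex.slitPlane_ne_zero hz
  have hlog : HasFDerivAt Complex.log
      ((ContinuousLinearMap.toSpanSingleton ℂ z⁻¹).restrictScalars ℝ) z :=
    (Complex.hasStrictDerivAt_log hz).hasDerivAt.hasFDerivAt.restrictScalars ℝ
  have hexp := (((Complex.ofRealCLM.comp Complex.reCLM).hasFDerivAt
    (x := Complex.log z)).const_mul (Complex.I * s)).cexp
  have hang : HasFDerivAt (fun x : ℂ => (φ x.im : ℂ))
      (Complex.ofRealCLM.comp (deriv φ (Complex.log z).im • Complex.imCLM)) (Complex.log z) :=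
    Complex.ofRealCLM.hasFDerivAt.comp (Complex.log z)
      ((hφ.differentiableAt (by simp)).hasDerivAt.comp_hasFDerivAt (Complex.log z)
        Complex.imCLM.hasFDerivAt)
  have h : HasFDerivAt (logWave s φ ∘ Complex.log) _ z := (hexp.mul hang).comp z hlog
  rw [(angularWave_eventuallyEq s φ hz₀).fderiv_eq, h.fderiv, angularWave_eq_logWave s φ hz₀]
  simp [logWave, hz₀]
  ring

/-- The superposition `A r^{-iμ} φ(θ) + B r^{iμ} φ(θ)`. -/
def wave (μ : ℝ) (φ : ℝ → ℝ) (A B z : ℂ) : ℂ :=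
  A * angularWave (-μ) φ z + B * angularWave μ φ z

theorem contDiffAt_wave (μ : ℝ) (A B : ℂ) (hz : z ∈ Complex.slitPlane)
    (hφ : ContDiffAt ℝ 1 φ z.arg) : ContDiffAt ℝ 1 (wave μ φ A B) z :=
  (contDiffAt_const.mul (contDiffAt_angularWave (-μ) hz hφ)).add
    (contDiffAt_const.mul (contDiffAt_angularWave μ hz hφ))

theorem fderiv_wave_self (μ : ℝ) (A B : ℂ) (hz : z ∈ Complex.slitPlane)
    (hφ : ContDiffAt ℝ 1 φ z.arg) :
    fderiv ℝ (wave μ φ A B) z z = wave μ φ (-(Complex.I * μ * A)) (Complex.I * μ * B) z := by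
  have hd (s : ℝ) := (contDiffAt_angularWave s hz hφ).differentiableAt (by simp)
  have h : HasFDerivAt (wave μ φ A B) _ z :=
    ((hd (-μ)).hasFDerivAt.const_mul A).add ((hd μ).hasFDerivAt.const_mul B)
  rw [h.fderiv]
  simp only [add_apply, smul_apply, smul_eq_mul, fderiv_angularWave_self _ hz hφ, wave]
  push_cast
  ring

theorem norm_wave_le (μ : ℝ) (A B : ℂ) (hz : z ≠ 0) (hL : |φ z.arg| ≤ L) :
    ‖wave μ φ A B z‖ ≤ (‖A‖ + ‖B‖) * L := by
  refine (norm_add_le _ _).trans ?_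
  rw [norm_mul, norm_mul, norm_angularWave _ _ hz, norm_angularWave _ _ hz, ← add_mul]
  gcongr

theorem im_conj_wave_mul_wave (μ : ℝ) (φ : ℝ → ℝ) (A B : ℂ) (hz : z ≠ 0) :
    (starRingEnd ℂ (wave μ φ A B z) *
      wave μ φ (-(Complex.I * μ * A)) (Complex.I * μ * B) z).im =
      μ * φ z.arg ^ 2 * (‖B‖ ^ 2 - ‖A‖ ^ 2) := by
  have hφ : φ z.arg ^ 2 = ‖angularWave μ φ z‖ ^ 2 := by rw [norm_angularWave μ φ hz, sq_abs]
  rw [hφ, wave, wave, angularWave_neg]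
  simp only [Complex.sq_norm, Complex.normSq_apply]
  simp
  ring

theorem contDiffAt_phi (μ c : ℝ) {θ : ℝ} (hθ : θ ≠ Real.pi / 4) : ContDiffAt ℝ 1 (phi μ c) θ := by
  rcases hθ.lt_or_gt with hθ | hθ
  · have h : phi μ c =ᶠ[𝓝 θ]
        fun θ => c * (Real.sinh (μ * θ) / Real.sinh (μ * (Real.pi / 4))) := by
      filter_upwards [gt_mem_nhds hθ] with x hx using if_pos hx.le
    exact ContDiffAt.congr_of_eventuallyEq (by fun_prop) h
  · have h : phi μ c =ᶠ[𝓝 θ]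
        fun θ => c * (Real.sinh (μ * (Real.pi - θ)) / Real.sinh (μ * (3 * Real.pi / 4))) := by
      filter_upwards [lt_mem_nhds hθ] with x hx using if_neg hx.not_ge
    exact ContDiffAt.congr_of_eventuallyEq (by fun_prop) h

theorem exists_abs_phi_le (μ c : ℝ) : ∃ L, ∀ z : ℂ, |phi μ c z.arg| ≤ L := by
  have hbound {f : ℝ → ℝ} (hf : Continuous f) :=
    (isCompact_Icc (a := -Real.pi) (b := Real.pi)).exists_bound_of_continuousOn hf.continuousOn
  obtain ⟨L₁, h₁⟩ := hbound
    (f := fun θ => c * (Real.sinh (μ * θ) / Real.sinh (μ * (Real.pi / 4)))) (by fun_prop)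
  obtain ⟨L₂, h₂⟩ := hbound
    (f := fun θ => c * (Real.sinh (μ * (Real.pi - θ)) / Real.sinh (μ * (3 * Real.pi / 4))))
    (by fun_prop)
  refine ⟨max L₁ L₂, fun z => ?_⟩
  have hz : z.arg ∈ Set.Icc (-Real.pi) Real.pi :=
    ⟨(Complex.neg_pi_lt_arg z).le, Complex.arg_le_pi z⟩
  unfold phi
  split_ifs
  · exact (h₁ _ hz).trans (le_max_left _ _)
  · exact (h₂ _ hz).trans (le_max_right _ _)

end AngularWave

/-! ### Conservation of the flux -/

section Flux

variable {Ω W : Set ℂ} {w σ k ρ : ℂ → ℝ} {b m t δ S M : ℝ} {u v : ℂ → ℂ} {G H : ℂ → ℂ × ℂ}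
  {φ : ℝ → ℝ} {μ : ℝ} {A B z : ℂ}

/-- The radial derivative `r ∂ᵣ v`, where `G` is the gradient of `v`. -/
def radialDeriv (G : ℂ → ℂ × ℂ) (z : ℂ) : ℂ := z.re * (G z).1 + z.im * (G z).2

/-- The radial flux density `σ k Im(ū r ∂ᵣ u)`, where `G` is the gradient of `u`. It is the
imaginary part of `σ ∇u · ∇(ρ ū)` when `∇ρ = k (x, y)`. -/
def fluxDensity (σ k : ℂ → ℝ) (u : ℂ → ℂ) (G : ℂ → ℂ × ℂ) (z : ℂ) : ℝ :=
  σ z * (k z * (starRingEnd ℂ (u z) * radialDeriv G z).im)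

theorem MemKer.integral_fluxDensity (hΩ : IsOpen Ω) (hw : Continuous w)
    (hpos : ∀ z ∈ Ω, 0 < w z) (hσ : Measurable σ) (hS : ∀ z, |σ z| ≤ S) (hu : MemKer Ω σ w b u)
    (hG : MemVWith Ω w b u G)
    (hρu : MemVWith Ω w (-b) (fun z => ρ z * u z) (mulGrad ρ u G))
    (hρ : ∀ z ∈ Ω, ∀ e, fderiv ℝ ρ z e = k z * (z.re * e.re + z.im * e.im)) :
    IntegrableOn (fluxDensity σ k u G) Ω ∧ ∫ z in Ω, fluxDensity σ k u G z = 0 := by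
  have hint := integrableOn_form hΩ hw hpos hG hρu hσ hS
  have hform : form Ω σ G (mulGrad ρ u G) = 0 :=
    hu.2 G hG.1 _ _ (memV_iff.2 ⟨_, hρu⟩) hρu.1
  have heq : ∀ z ∈ Ω, RCLike.im ((σ z : ℂ) * ((G z).1 * starRingEnd ℂ (mulGrad ρ u G z).1 +
      (G z).2 * starRingEnd ℂ (mulGrad ρ u G z).2)) = fluxDensity σ k u G z := by
    intro z hz
    simp only [fluxDensity, radialDeriv, mulGrad, hρ z hz, RCLike.im_to_complex, Complex.add_im,
      Complex.mul_im, Complex.add_re, Complex.mul_re, Complex.conj_im, Complex.conj_re,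
      Complex.ofReal_im, Complex.ofReal_re, Complex.one_re, Complex.one_im, Complex.I_re,
      Complex.I_im]
    ring
  constructor
  · exact IntegrableOn.congr_fun hint.im heq hΩ.measurableSet
  · rw [← setIntegral_congr_fun hΩ.measurableSet heq, integral_im hint]
    rw [form] at hform
    rw [hform, map_zero]

theorem ae_radialDeriv_eq (hφ : ∀ᵐ θ, ContDiffAt ℝ 1 φ θ) (hΩ : IsOpen Ω) (hW : IsOpen W)
    (hG : IsWeakGrad Ω u G) (hH : IsWeakGrad Ω v H)
    (huv : ∀ᵐ z, z ∈ Ω ∩ W → u z = wave μ φ A B z + v z) :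
    ∀ᵐ z, z ∈ Ω ∩ W → radialDeriv G z =
      wave μ φ (-(Complex.I * μ * A)) (Complex.I * μ * B) z + radialDeriv H z := by
  set U : Set ℂ := {z | z ∈ (Ω ∩ W) ∩ Complex.slitPlane ∧ ContDiffAt ℝ 1 φ z.arg}
  have hU : IsOpen U := by
    refine isOpen_iff_mem_nhds.2 fun z hz => ?_
    have hsmooth : ∀ᶠ x in 𝓝 z, ContDiffAt ℝ 1 φ x.arg :=
      (Complex.continuousAt_arg hz.1.2).eventually (hz.2.eventually (by simp))
    filter_upwards [((hΩ.inter hW).inter Complex.isOpen_slitPlane).mem_nhds hz.1, hsmooth]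
      with x hx hxφ using ⟨hx, hxφ⟩
  have hUΩ : U ⊆ Ω := fun z hz => hz.1.1.1
  have hwave : ContDiffOn ℝ 1 (wave μ φ A B) U := fun z hz =>
    (contDiffAt_wave μ A B hz.1.2 hz.2).contDiffWithinAt
  have huvU : ∀ᵐ z, z ∈ U → u z = wave μ φ A B z + v z :=
    huv.mono fun z hz hzU => hz hzU.1.1
  rw [isWeakGrad_iff] at hG hH
  have hpartial {e : ℂ} {g h : ℂ → ℂ} (hg : HasWeakDeriv Ω e u g) (hh : HasWeakDeriv Ω e v h) :=
    (hg.mono hUΩ).ae_unique hU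
      ((hasWeakDeriv_of_contDiffOn hU hwave e).add (hh.mono hUΩ)) huvU
  have hslit : ∀ᵐ z : ℂ, z ∈ Complex.slitPlane := by
    filter_upwards [ae_comp_arg (Measure.ae_ne volume Real.pi), Measure.ae_ne volume (0 : ℂ)]
      with z hz hz₀ using Complex.mem_slitPlane_iff_arg.2 ⟨hz, hz₀⟩
  filter_upwards [hpartial hG.1 hH.1, hpartial hG.2 hH.2, ae_comp_arg hφ, hslit]
    with z h₁ h₂ hφz hz hzD
  have hzU : z ∈ U := ⟨⟨hzD, hz⟩, hφz⟩
  have hradial : fderiv ℝ (wave μ φ A B) z z =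
      z.re * fderiv ℝ (wave μ φ A B) z 1 + z.im * fderiv ℝ (wave μ φ A B) z Complex.I := by
    have h := map_add (fderiv ℝ (wave μ φ A B) z) (z.re • (1 : ℂ)) (z.im • Complex.I)
    rwa [map_smul, map_smul, Complex.real_smul, Complex.real_smul, Complex.real_smul,
      Complex.real_smul, mul_one, Complex.re_add_im] at h
  rw [← fderiv_wave_self μ A B hz hφz, hradial, radialDeriv, h₁ hzU, h₂ hzU, radialDeriv]
  ring

theorem norm_le_mul_sqrt_normDensity (hw : 0 < w z) (v : ℂ → ℂ) (H : ℂ → ℂ × ℂ) :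
    ‖v z‖ ≤ w z * √(normDensity w 0 v H z) := by
  rw [← div_le_iff₀' hw]
  refine Real.le_sqrt_of_sq_le ?_
  have hrpow : w z ^ (2 * ((0 : ℝ) - 1)) = (w z ^ 2)⁻¹ := by
    rw [← Real.rpow_natCast, ← Real.rpow_neg hw.le]
    norm_num
  rw [normDensity, hrpow, div_pow, div_eq_inv_mul]
  exact le_add_of_nonneg_right (by positivity)

theorem norm_radialDeriv_le (hw : 0 < w z) (v : ℂ → ℂ) (H : ℂ → ℂ × ℂ) :
    ‖radialDeriv H z‖ ≤ 2 * ‖z‖ * √(normDensity w 0 v H z) := by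
  have hv : 0 ≤ w z ^ (2 * ((0 : ℝ) - 1)) * ‖v z‖ ^ 2 := by positivity
  have h₁ : ‖(H z).1‖ ≤ √(normDensity w 0 v H z) := by
    refine Real.le_sqrt_of_sq_le ?_
    rw [normDensity, mul_zero, Real.rpow_zero]
    linarith [sq_nonneg ‖(H z).2‖]
  have h₂ : ‖(H z).2‖ ≤ √(normDensity w 0 v H z) := by
    refine Real.le_sqrt_of_sq_le ?_
    rw [normDensity, mul_zero, Real.rpow_zero]
    linarith [sq_nonneg ‖(H z).1‖]
  calc ‖radialDeriv H z‖ ≤ |z.re| * ‖(H z).1‖ + |z.im| * ‖(H z).2‖ := by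
        simpa [radialDeriv] using norm_add_le ((z.re : ℂ) * (H z).1) (z.im * (H z).2)
    _ ≤ ‖z‖ * √(normDensity w 0 v H z) + ‖z‖ * √(normDensity w 0 v H z) := by
        gcongr
        · exact Complex.abs_re_le_norm z
        · exact Complex.abs_im_le_norm z
    _ = 2 * ‖z‖ * √(normDensity w 0 v H z) := by ring

theorem abs_im_conj_mul_add_sub_le {a a' d d' : ℂ} {α α' κ κ' : ℝ} (ha : ‖a‖ ≤ α) (ha' : ‖a'‖ ≤ α')
    (hd : ‖d‖ ≤ κ) (hd' : ‖d'‖ ≤ κ') :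
    |(starRingEnd ℂ (a + a') * (d + d')).im - (starRingEnd ℂ a * d).im| ≤
      α * κ' + α' * κ + α' * κ' := by
  have hexpand : starRingEnd ℂ (a + a') * (d + d') - starRingEnd ℂ a * d =
      starRingEnd ℂ a * d' + starRingEnd ℂ a' * d + starRingEnd ℂ a' * d' := by
    rw [map_add]
    ring
  rw [← Complex.sub_im, hexpand]
  refine (Complex.abs_im_le_norm _).trans (norm_add₃_le.trans ?_)
  simp only [norm_mul, RCLike.norm_conj]
  have hα := (norm_nonneg a).trans ha
  have hα' := (norm_nonneg a').trans ha'
  gcongr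

theorem remainder_le_of_sq_le {P q α κ : ℝ} (ht : 0 < t) (hδ : 0 < δ) (hq₀ : 0 ≤ q)
    (hq : q ^ 2 ≤ δ ^ 2 * P) (hS : 0 ≤ S) (hM : 0 ≤ M) (hm : 0 ≤ m) (hα : 0 ≤ α) (hκ : 0 ≤ κ) :
    S * (M / t ^ 2 * (α * (2 * (2 * t) * q) + m * t * q * κ + m * t * q * (2 * (2 * t) * q))) ≤
      S * M * (4 * α + m * κ + 4 * m) * (δ / t ^ 2 + (δ + δ ^ 2) * P) := by
  have hP : 0 ≤ P := nonneg_of_mul_nonneg_right ((sq_nonneg q).trans hq) (by positivity)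
  have hamgm : q / t ≤ δ / t ^ 2 + δ * P := by
    have hsq : 0 ≤ δ * (1 / t - q / δ) ^ 2 := by positivity
    have hexp : δ * (1 / t - q / δ) ^ 2 = δ / t ^ 2 + q ^ 2 / δ - 2 * (q / t) := by
      field_simp
      ring
    have hqδ : q ^ 2 / δ ≤ δ * P := by
      rw [div_le_iff₀ hδ]
      linarith
    have hqt : 0 ≤ q / t := by positivity
    linarith
  calc S * (M / t ^ 2 * (α * (2 * (2 * t) * q) + m * t * q * κ + m * t * q * (2 * (2 * t) * q)))
      = S * M * ((4 * α + m * κ) * (q / t) + 4 * m * q ^ 2) := by field_simp; ring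
    _ ≤ S * M * ((4 * α + m * κ) * (δ / t ^ 2 + δ * P) + 4 * m * (δ ^ 2 * P)) := by gcongr
    _ ≤ S * M * ((4 * α + m * κ + 4 * m) * (δ / t ^ 2 + (δ + δ ^ 2) * P)) := by
        have h₁ : 0 ≤ (4 * α + m * κ) * (δ ^ 2 * P) := by positivity
        have h₂ : 0 ≤ 4 * m * (δ / t ^ 2 + δ * P) := by positivity
        gcongr
        linarith
    _ = _ := by ring

theorem abs_fluxDensity_sub_le {a d : ℂ} {α κ : ℝ} (ht : 0 < t) (hδ : 0 < δ) (hz : ‖z‖ ≤ 2 * t)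
    (hw : 0 < w z) (hwm : w z ≤ m * t) (hwδ : w z ^ (2 * b) ≤ δ ^ 2) (hσ : |σ z| ≤ S)
    (hM : 0 ≤ M) (hk : |k z| ≤ M / t ^ 2) (ha : ‖a‖ ≤ α) (hd : ‖d‖ ≤ κ) (hu : u z = a + v z)
    (hG : radialDeriv G z = d + radialDeriv H z) :
    |fluxDensity σ k u G z - σ z * (k z * (starRingEnd ℂ a * d).im)| ≤
      S * M * (4 * α + m * κ + 4 * m) *
        (δ / t ^ 2 + (δ + δ ^ 2) * normDensity w (-b) v H z) := by
  set q := √(normDensity w 0 v H z) with hq_def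
  have hP : 0 ≤ normDensity w (-b) v H z := normDensity_nonneg hw (-b) v H
  have hq : q ^ 2 ≤ δ ^ 2 * normDensity w (-b) v H z := by
    rw [hq_def, Real.sq_sqrt (normDensity_nonneg hw 0 v H), normDensity_eq_rpow_mul hw (-b) 0,
      zero_sub, neg_neg]
    gcongr
  have hv : ‖v z‖ ≤ m * t * q := (norm_le_mul_sqrt_normDensity hw v H).trans (by gcongr)
  have hH : ‖radialDeriv H z‖ ≤ 2 * (2 * t) * q := (norm_radialDeriv_le hw v H).trans (by gcongr)
  have hm : 0 ≤ m := (pos_of_mul_pos_left (hw.trans_le hwm) ht.le).le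
  have hS : 0 ≤ S := (abs_nonneg _).trans hσ
  have hfactor : fluxDensity σ k u G z - σ z * (k z * (starRingEnd ℂ a * d).im) =
      σ z * (k z * ((starRingEnd ℂ (a + v z) * (d + radialDeriv H z)).im -
        (starRingEnd ℂ a * d).im)) := by
    rw [fluxDensity, hu, hG]
    ring
  rw [hfactor, abs_mul, abs_mul]
  refine le_trans ?_ (remainder_le_of_sq_le ht hδ (Real.sqrt_nonneg _) hq hS hM hm
    ((norm_nonneg a).trans ha) ((norm_nonneg d).trans hd))
  gcongr
  exact abs_im_conj_mul_add_sub_le ha hv hd hH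

theorem abs_integral_le_of_ae_abs_le {f p : ℂ → ℝ} {a R : ℝ} (hR : 0 ≤ R) (hΩ : MeasurableSet Ω)
    (hp : IntegrableOn p Ω)
    (hf : ∀ᵐ z, |f z| ≤ (Metric.closedBall 0 R).indicator (fun _ => a) z + Ω.indicator p z) :
    |∫ z, f z| ≤ a * (Real.pi * R ^ 2) + ∫ z in Ω, p z := by
  have hball : MeasurableSet (Metric.closedBall (0 : ℂ) R) :=
    Metric.isClosed_closedBall.measurableSet
  have ha : IntegrableOn (fun _ : ℂ => a) (Metric.closedBall 0 R) :=
    integrableOn_const (measure_closedBall_lt_top).ne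
  have ha' := ha.integrable_indicator hball
  have hp' := hp.integrable_indicator hΩ
  refine (norm_integral_le_of_norm_le (f := f) (ha'.add hp') hf).trans_eq ?_
  simp only [Pi.add_apply]
  rw [integral_add ha' hp', integral_indicator hball, integral_indicator hΩ, setIntegral_const,
    Measure.real, Complex.volume_closedBall]
  simp only [ENNReal.toReal_mul, ENNReal.toReal_pow, ENNReal.coe_toReal, NNReal.coe_real_pi,
    ENNReal.toReal_ofReal hR, smul_eq_mul]
  ring

end Flux

section FluxLimit

variable {Ω W : Set ℂ} {w σ : ℂ → ℝ} {b m t ε S : ℝ} {u v : ℂ → ℂ} {G H : ℂ → ℂ × ℂ}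
  {g s φ : ℝ → ℝ} {μ L : ℝ} {A B : ℂ}

/-- The conditions under which the identity for the flux through the annulus of size `t` is
available and its remainder is controlled by `ε`: inside the annulus the expansion holds and the
weight `w` is comparable to `t`, and the cut-off solution belongs to the dual space. -/
structure IsFluxScale (Ω W : Set ℂ) (w : ℂ → ℝ) (b m : ℝ) (g : ℝ → ℝ) (ε t : ℝ) : Prop where
  pos : 0 < t
  annulus_subset : annulus t ⊆ W
  weight_le : ∀ z ∈ annulus t, w z ≤ m * t
  rpow_le : ∀ z ∈ annulus t, w z ^ (2 * b) ≤ ε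
  exists_rpow_le : ∃ C, ∀ z ∈ Ω, radialCutoff g t z ≠ 0 → w z ^ (2 * (-b - b)) ≤ C

theorem MemKer.integral_fluxDensity_cutoffSlope (hΩ : IsOpen Ω) (hw : Continuous w)
    (hpos : ∀ z ∈ Ω, 0 < w z) (hσ : Measurable σ) (hS : ∀ z, |σ z| ≤ S) (hu : MemKer Ω σ w b u)
    (hG : MemVWith Ω w b u G) (hg : IsTransition g) (ht : IsFluxScale Ω W w b m g ε t) :
    IntegrableOn (fluxDensity σ (cutoffSlope g t) u G) Ω ∧
      ∫ z in Ω, fluxDensity σ (cutoffSlope g t) u G z = 0 := by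
  obtain ⟨M, hM⟩ := hg.exists_abs_deriv_le
  obtain ⟨C, hC⟩ := ht.exists_rpow_le
  have hρu := hG.ofReal_mul_of_weight_le hΩ hpos (hg.contDiff_radialCutoff ht.pos)
    (fun z => hg.mem_Icc _)
    (fun z hz => hg.sq_fderiv_radialCutoff_mul_le hM ht.pos (hpos z hz).le (ht.weight_le z)) hC
  exact hu.integral_fluxDensity hΩ hw hpos hσ hS hG hρu
    fun z _ => hg.fderiv_radialCutoff ht.pos z

theorem exists_ae_abs_fluxDensity_sub_le (hφ : ∀ᵐ θ, ContDiffAt ℝ 1 φ θ)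
    (hL : ∀ z : ℂ, |φ z.arg| ≤ L) (hΩ : IsOpen Ω) (hW : IsOpen W) (hpos : ∀ z ∈ Ω, 0 < w z)
    (hS : ∀ z, |σ z| ≤ S) (hσ : ∀ᵐ z, z ∈ W → Ω.indicator σ z = s z.arg) (hG : IsWeakGrad Ω u G)
    (hH : IsWeakGrad Ω v H) (huv : ∀ᵐ z, z ∈ Ω ∩ W → u z = wave μ φ A B z + v z)
    (hg : IsTransition g) :
    ∃ C, ∀ δ > 0, ∀ t, IsFluxScale Ω W w b m g (δ ^ 2) t →
      ∀ᵐ z, |Ω.indicator (fluxDensity σ (cutoffSlope g t) u G) z -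
          cutoffSlope g t z * (s z.arg * (μ * φ z.arg ^ 2 * (‖B‖ ^ 2 - ‖A‖ ^ 2)))| ≤
        (Metric.closedBall 0 (2 * t)).indicator (fun _ => C * (δ / t ^ 2)) z +
          Ω.indicator (fun z => C * ((δ + δ ^ 2) * normDensity w (-b) v H z)) z := by
  obtain ⟨M, hM⟩ := hg.exists_abs_deriv_le
  have hM₀ : 0 ≤ M := (abs_nonneg _).trans (hM 0)
  have hS₀ : 0 ≤ S := (abs_nonneg _).trans (hS 0)
  have hL₀ : 0 ≤ L := (abs_nonneg _).trans (hL 0)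
  set A' := -(Complex.I * μ * A)
  set B' := Complex.I * μ * B
  refine ⟨S * M * (4 * ((‖A‖ + ‖B‖) * L) + |m| * ((‖A'‖ + ‖B'‖) * L) + 4 * |m|),
    fun δ hδ t ht => ?_⟩
  set C := S * M * (4 * ((‖A‖ + ‖B‖) * L) + |m| * ((‖A'‖ + ‖B'‖) * L) + 4 * |m|)
  have hC₀ : 0 ≤ C := by positivity
  have ht₀ := ht.pos
  have hball (z : ℂ) : 0 ≤ (Metric.closedBall 0 (2 * t)).indicator (fun _ => C * (δ / t ^ 2)) z :=
    Set.indicator_nonneg (fun _ _ => by positivity) z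
  filter_upwards [hσ, huv, ae_radialDeriv_eq hφ hΩ hW hG hH huv] with z hσz hu hradial
  by_cases hz : z ∈ annulus t
  swap
  · have hflux : Ω.indicator (fluxDensity σ (cutoffSlope g t) u G) z = 0 :=
      Set.indicator_apply_eq_zero.2 fun _ => by
        simp only [fluxDensity, hg.cutoffSlope_eq_zero ht₀ hz, zero_mul, mul_zero]
    rw [hflux, hg.cutoffSlope_eq_zero ht₀ hz, zero_mul, sub_zero, abs_zero]
    refine add_nonneg (hball z) (Set.indicator_nonneg (fun x hx => ?_) z)
    have hP := normDensity_nonneg (hpos x hx) (-b) v H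
    positivity
  have hzW : z ∈ W := ht.annulus_subset hz
  by_cases hzΩ : z ∈ Ω
  swap
  · rw [← hσz hzW, Set.indicator_of_notMem hzΩ, Set.indicator_of_notMem hzΩ,
      Set.indicator_of_notMem hzΩ, zero_mul, mul_zero, sub_zero, abs_zero, add_zero]
    exact hball z
  have hz₀ : z ≠ 0 := norm_pos_iff.1 (ht₀.trans_le hz.1)
  have hwz : w z ≤ |m| * t := (ht.weight_le z hz).trans (by gcongr; exact le_abs_self m)
  have h := abs_fluxDensity_sub_le ht₀ hδ hz.2 (hpos z hzΩ) hwz (ht.rpow_le z hz) (hS z) hM₀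
    (abs_cutoffSlope_le hM ht₀ hz) (norm_wave_le μ A B hz₀ (hL z))
    (norm_wave_le μ A' B' hz₀ (hL z)) (hu ⟨hzΩ, hzW⟩) (hradial ⟨hzΩ, hzW⟩)
  rw [im_conj_wave_mul_wave μ φ A B hz₀] at h
  rw [Set.indicator_of_mem hzΩ] at hσz
  rw [Set.indicator_of_mem hzΩ, Set.indicator_of_mem hzΩ,
    Set.indicator_of_mem (mem_closedBall_zero_iff.2 hz.2), ← hσz hzW, mul_left_comm, ← mul_add]
  exact h

theorem IsTransition.integral_cutoffSlope_mul_waveFlux (hg : IsTransition g) (ht : 0 < t)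
    (s φ : ℝ → ℝ) (μ K : ℝ) :
    ∫ z : ℂ, cutoffSlope g t z * (s z.arg * (μ * φ z.arg ^ 2 * K)) =
      (g 2 - g 1) * ((μ * ∫ θ in Set.Ioo (-Real.pi) Real.pi, s θ * φ θ ^ 2) * K) := by
  rw [hg.integral_cutoffSlope_mul ht fun θ => s θ * (μ * φ θ ^ 2 * K),
    mul_right_comm, ← integral_const_mul, ← integral_const_mul, ← integral_const_mul]
  refine integral_congr_ae (.of_forall fun θ => ?_)
  ring

theorem eq_zero_of_forall_abs_le {x C E : ℝ}
    (h : ∀ δ > 0, |x| ≤ C * (4 * Real.pi * δ) + C * ((δ + δ ^ 2) * E)) : x = 0 := by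
  have hlim : Tendsto (fun δ : ℝ => C * (4 * Real.pi * δ) + C * ((δ + δ ^ 2) * E)) (𝓝[>] 0)
      (𝓝 0) :=
    ((by fun_prop : Continuous _).tendsto' 0 0 (by simp)).mono_left nhdsWithin_le_nhds
  exact abs_nonpos_iff.1 (ge_of_tendsto hlim (eventually_mem_nhdsWithin.mono h))

theorem MemKer.norm_eq_of_expansion (hφ : ∀ᵐ θ, ContDiffAt ℝ 1 φ θ)
    (hL : ∀ z : ℂ, |φ z.arg| ≤ L)
    (hflux : μ * ∫ θ in Set.Ioo (-Real.pi) Real.pi, s θ * φ θ ^ 2 ≠ 0) (hΩ : IsOpen Ω)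
    (hW : IsOpen W) (hw : Continuous w) (hpos : ∀ z ∈ Ω, 0 < w z) (hσ : Measurable σ)
    (hS : ∀ z, |σ z| ≤ S) (hσs : ∀ᵐ z, z ∈ W → Ω.indicator σ z = s z.arg) (hg : IsTransition g)
    (hscale : ∀ ε > 0, ∃ t, IsFluxScale Ω W w b m g ε t) (hu : MemKer Ω σ w b u)
    (hv : MemV Ω w (-b) v) (huv : ∀ᵐ z, z ∈ Ω ∩ W → u z = wave μ φ A B z + v z) :
    ‖A‖ = ‖B‖ := by
  obtain ⟨G, hG⟩ := memV_iff.1 hu.1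
  obtain ⟨H, hH⟩ := memV_iff.1 hv
  obtain ⟨C, hC⟩ := exists_ae_abs_fluxDensity_sub_le (b := b) (m := m) hφ hL hΩ hW hpos hS hσs
    hG.1 hH.1 huv hg
  set K := ‖B‖ ^ 2 - ‖A‖ ^ 2
  set E := ∫ z in Ω, normDensity w (-b) v H z
  set Φ := (g 2 - g 1) * ((μ * ∫ θ in Set.Ioo (-Real.pi) Real.pi, s θ * φ θ ^ 2) * K)
  by_contra hAB
  have hK₀ : K ≠ 0 := fun h => hAB
    ((sq_eq_sq₀ (norm_nonneg _) (norm_nonneg _)).1 (sub_eq_zero.1 h)).symm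
  have hΦ₀ : Φ ≠ 0 := mul_ne_zero (sub_ne_zero.2 hg.ne.symm) (mul_ne_zero hflux hK₀)
  have hbound : ∀ δ > 0, |Φ| ≤ C * (4 * Real.pi * δ) + C * ((δ + δ ^ 2) * E) := by
    intro δ hδ
    obtain ⟨t, ht⟩ := hscale (δ ^ 2) (by positivity)
    have ht₀ := ht.pos
    obtain ⟨hint, hzero⟩ := hu.integral_fluxDensity_cutoffSlope hΩ hw hpos hσ hS hG hg ht
    have hwave : Integrable fun z : ℂ =>
        cutoffSlope g t z * (s z.arg * (μ * φ z.arg ^ 2 * K)) :=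
      .of_integral_ne_zero (by rwa [hg.integral_cutoffSlope_mul_waveFlux ht₀])
    have h := abs_integral_le_of_ae_abs_le (by positivity) hΩ.measurableSet
      (((hH.integrableOn hΩ hw hpos).const_mul (δ + δ ^ 2)).const_mul C) (hC δ hδ t ht)
    rw [integral_sub (hint.integrable_indicator hΩ.measurableSet) hwave,
      hg.integral_cutoffSlope_mul_waveFlux ht₀, integral_indicator hΩ.measurableSet, hzero,
      zero_sub, abs_neg, integral_const_mul, integral_const_mul] at h
    refine h.trans_eq ?_
    field_simp
    ring
  exact hΦ₀ (eq_zero_of_forall_abs_le hbound)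

end FluxLimit

/-! ### The corner and the point at infinity -/

section Corner

variable {Ω P M W : Set ℂ} {w : ℂ → ℝ} {b m β σp σm μ c ε : ℝ} {u v : ℂ → ℂ} {g ψ : ℝ → ℝ}
  {A B z : ℂ}

theorem isOpen_Xi : IsOpen Xi := isOpen_lt continuous_const Complex.continuous_im

theorem mem_Xi_iff_arg : z ∈ Xi ↔ z.arg ∈ Set.Ioo 0 Real.pi := by
  refine ⟨fun hz => ?_, fun hz => ?_⟩
  · have him : 0 < z.im := hz
    refine ⟨(Complex.arg_nonneg_iff.2 him.le).lt_of_ne' fun h => him.ne' ?_,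
      Complex.arg_lt_pi_iff.2 (Or.inr him.ne')⟩
    exact (Complex.arg_eq_zero_iff.1 h).2
  · refine (Complex.arg_nonneg_iff.1 hz.1.le).lt_of_ne' fun h => ?_
    rcases le_or_gt 0 z.re with hre | hre
    · exact hz.1.ne' (Complex.arg_eq_zero_iff.2 ⟨hre, h⟩)
    · exact hz.2.ne (Complex.arg_eq_pi_iff.2 ⟨hre, h⟩)

theorem measurable_coeff (σp σm : ℝ) (hP : IsOpen P) (hM : IsOpen M) :
    Measurable (coeff σp σm P M) :=
  Measurable.ite hP.measurableSet measurable_const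
    (Measurable.ite hM.measurableSet measurable_const measurable_const)

theorem abs_coeff_le (σp σm : ℝ) (P M : Set ℂ) (z : ℂ) : |coeff σp σm P M z| ≤ |σp| + |σm| := by
  unfold coeff
  split_ifs
  · exact le_add_of_nonneg_right (abs_nonneg _)
  · exact le_add_of_nonneg_left (abs_nonneg _)
  · rw [abs_zero]
    positivity

/-- In the region `W`, the parts `P` and `M` of `Ω` lie in the upper half plane and are separated
by the ray `θ = π/4`. -/
structure IsSectorial (Ω P M W : Set ℂ) : Prop where
  isOpen_p : IsOpen P
  isOpen_m : IsOpen M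
  disjoint : Disjoint P M
  union_subset : P ∪ M ⊆ Ω
  inter_subset_Xi : (P ∪ M) ∩ W ⊆ Xi
  sector_m : sector 0 (Real.pi / 4) ∩ W ⊆ M
  sector_p : sector (Real.pi / 4) Real.pi ∩ W ⊆ P

theorem IsSectorial.indicator_coeff (h : IsSectorial Ω P M W) (σp σm : ℝ) (hz : z ∈ W)
    (hθ : z.arg ≠ Real.pi / 4) :
    Ω.indicator (coeff σp σm P M) z =
      (Set.Ioo 0 Real.pi).indicator (sigmaAngle σp σm) z.arg := by
  by_cases hzXi : z.arg ∈ Set.Ioo 0 Real.pi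
  · have hz₀ : z ≠ 0 := by
      rintro rfl
      exact hzXi.1.ne' Complex.arg_zero
    rw [Set.indicator_of_mem hzXi]
    rcases hθ.lt_or_gt with hlt | hgt
    · have hzM : z ∈ M := h.sector_m ⟨⟨hz₀, hzXi.1, hlt⟩, hz⟩
      rw [Set.indicator_of_mem (h.union_subset (Or.inr hzM)), coeff,
        if_neg (h.disjoint.notMem_of_mem_right hzM), if_pos hzM, sigmaAngle, if_pos hlt]
    · have hzP : z ∈ P := h.sector_p ⟨⟨hz₀, hgt, hzXi.2⟩, hz⟩
      rw [Set.indicator_of_mem (h.union_subset (Or.inl hzP)), coeff, if_pos hzP, sigmaAngle,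
        if_neg hgt.not_gt]
  · have hzPM : z ∉ P ∪ M := fun hmem => hzXi (mem_Xi_iff_arg.1 (h.inter_subset_Xi ⟨hmem, hz⟩))
    rw [Set.indicator_of_notMem hzXi]
    refine Set.indicator_apply_eq_zero.2 fun _ => ?_
    rw [coeff, if_neg fun hzP => hzPM (Or.inl hzP), if_neg fun hzM => hzPM (Or.inr hzM)]

theorem setIntegral_indicator_Ioo (f h : ℝ → ℝ) :
    ∫ θ in Set.Ioo (-Real.pi) Real.pi, (Set.Ioo 0 Real.pi).indicator f θ * h θ =
      ∫ θ in (0 : ℝ)..Real.pi, f θ * h θ := by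
  simp only [← Set.indicator_mul_left]
  rw [setIntegral_indicator measurableSet_Ioo, Set.inter_eq_self_of_subset_right
      (Set.Ioo_subset_Ioo_left (neg_nonpos.2 Real.pi_pos.le)),
    ← integral_Ioc_eq_integral_Ioo, ← intervalIntegral.integral_of_le Real.pi_pos.le]

theorem IsSectorial.norm_eq_of_expansion (h : IsSectorial Ω P M W)
    (hflux : μ * ∫ θ in (0 : ℝ)..Real.pi, sigmaAngle σp σm θ * phi μ c θ ^ 2 ≠ 0)
    (hΩ : IsOpen Ω) (hW : IsOpen W) (hw : Continuous w) (hpos : ∀ z ∈ Ω, 0 < w z)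
    (hg : IsTransition g) (hscale : ∀ ε > 0, ∃ t, IsFluxScale Ω W w b m g ε t)
    (hu : MemKer Ω (coeff σp σm P M) w b u) (hv : MemV Ω w (-b) v)
    (huv : ∀ᵐ z, z ∈ Ω ∩ W → u z = wave μ (phi μ c) A B z + v z) : ‖A‖ = ‖B‖ := by
  obtain ⟨L, hL⟩ := exists_abs_phi_le μ c
  have hθ : ∀ᵐ θ : ℝ, θ ≠ Real.pi / 4 := Measure.ae_ne volume _
  rw [← setIntegral_indicator_Ioo] at hflux
  exact hu.norm_eq_of_expansion (hθ.mono fun θ => contDiffAt_phi μ c) hL hflux hΩ hW hw hpos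
    (measurable_coeff σp σm h.isOpen_p h.isOpen_m) (abs_coeff_le σp σm P M)
    ((ae_comp_arg hθ).mono fun z hz hzW => h.indicator_coeff σp σm hzW hz) hg hscale hv huv

theorem OuterGeometry.isSectorial {Ωp Ωm : Set ℂ} {O' : ℂ} (h : OuterGeometry Ω Ωp Ωm O') :
    IsSectorial Ω Ωp Ωm (Metric.ball 0 1) where
  isOpen_p := h.isOpen_p
  isOpen_m := h.isOpen_m
  disjoint := h.disjoint
  union_subset := h.union.trans_subset Set.sdiff_subset
  inter_subset_Xi := by
    have hball : Metric.ball (0 : ℂ) 1 ⊆ Metric.ball 0 2 := Metric.ball_subset_ball one_le_two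
    rintro z ⟨hzP | hzM, hz⟩
    · have hmem := h.corner_p.subset ⟨hzP, hball hz⟩
      exact mem_Xi_iff_arg.2 ⟨(by positivity : 0 < Real.pi / 4).trans hmem.1.2.1, hmem.1.2.2⟩
    · have hmem := h.corner_m.subset ⟨hzM, hball hz⟩
      exact mem_Xi_iff_arg.2 ⟨hmem.1.2.1, hmem.1.2.2.trans (by linarith [Real.pi_pos])⟩
  sector_m z hz := (h.corner_m.superset ⟨hz.1, Metric.ball_subset_ball one_le_two hz.2⟩).1
  sector_p z hz := (h.corner_p.superset ⟨hz.1, Metric.ball_subset_ball one_le_two hz.2⟩).1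

theorem InnerGeometry.exists_isSectorial {Ξp Ξm : Set ℂ} {γ : ℝ → ℂ}
    (h : InnerGeometry Ξp Ξm γ) : ∃ R, ∀ R' ≥ R, IsSectorial Xi Ξp Ξm {z | R' < ‖z‖} := by
  obtain ⟨R, hRm, hRp⟩ := h.far
  have hsub : Ξp ∪ Ξm ⊆ Xi := h.union.trans_subset Set.sdiff_subset
  exact ⟨R, fun R' hR => ⟨h.isOpen_p, h.isOpen_m, h.disjoint, hsub,
    Set.inter_subset_left.trans hsub, fun z hz => hRm z hz.1 (hR.trans_lt hz.2),
    fun z hz => hRp z hz.1 (hR.trans_lt hz.2)⟩⟩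

theorem OuterGeometry.zero_notMem {Ωp Ωm : Set ℂ} {O' : ℂ} (h : OuterGeometry Ω Ωp Ωm O') :
    (0 : ℂ) ∉ Ω := by
  have h₀ : (0 : ℂ) ∈ segment ℝ 0 O' ∩ frontier Ω := h.endpoints.superset (Or.inl rfl)
  rw [h.isOpen.frontier_eq] at h₀
  exact h₀.2.2

theorem exists_isFluxScale_outerWeight (Ω : Set ℂ) (hβ : 0 < β) (hg : ∀ r ≤ 1, g r = 0)
    (hε : 0 < ε) : ∃ t, IsFluxScale Ω (Metric.ball 0 1) outerWeight β 2 g ε t := by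
  have hlim : Tendsto (fun t : ℝ => (2 * t) ^ (2 * β)) (𝓝[>] 0) (𝓝 0) := by
    refine (Continuous.tendsto' ?_ 0 0 ?_).mono_left nhdsWithin_le_nhds
    · exact (continuous_const.mul continuous_id).rpow_const fun _ => Or.inr (by positivity)
    · rw [mul_zero, Real.zero_rpow (by positivity)]
  obtain ⟨t, htε, ht₀, ht⟩ := ((hlim.eventually (gt_mem_nhds hε)).and
    (Ioo_mem_nhdsGT (one_half_pos (α := ℝ)))).exists
  refine ⟨t, ht₀, fun z hz => ?_, fun z hz => hz.2, fun z hz => ?_,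
    t ^ (2 * (-β - β)), fun z _ hz => ?_⟩
  · exact mem_ball_zero_iff.2 (hz.2.trans_lt (by linarith))
  · exact (Real.rpow_le_rpow (norm_nonneg z) hz.2 (by positivity)).trans htε.le
  · have hzt : t < ‖z‖ := by
      by_contra! hle
      exact hz (hg _ ((div_le_one ht₀).2 hle))
    exact Real.rpow_le_rpow_of_nonpos ht₀ hzt.le (by linarith)

theorem exists_isFluxScale_innerWeight (Ω : Set ℂ) (hβ : 0 < β) (hg : ∀ r, 2 ≤ r → g r = 0)
    (R : ℝ) (hε : 0 < ε) : ∃ t, IsFluxScale Ω {z | R < ‖z‖} innerWeight (-β) 3 g ε t := by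
  have hlim : Tendsto (fun t : ℝ => t ^ (-(2 * β))) atTop (𝓝 0) :=
    tendsto_rpow_neg_atTop (by positivity)
  obtain ⟨t, htε, ht⟩ := ((hlim.eventually (gt_mem_nhds hε)).and
    (eventually_gt_atTop (max R 1))).exists
  obtain ⟨hR, ht₁⟩ := max_lt_iff.1 ht
  have ht₀ : 0 < t := one_pos.trans ht₁
  refine ⟨t, ht₀, fun z hz => hR.trans_le hz.1, fun z hz => ?_, fun z hz => ?_,
    (3 * t) ^ (2 * (- -β - -β)), fun z _ hz => ?_⟩
  · rw [innerWeight]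
    linarith [hz.2]
  · rw [innerWeight, mul_neg]
    refine (Real.rpow_le_rpow_of_nonpos ht₀ ?_ (by linarith)).trans htε.le
    linarith [hz.1]
  · have hzt : ‖z‖ < 2 * t := by
      by_contra! hle
      exact hz (hg _ ((le_div_iff₀ ht₀).2 hle))
    rw [innerWeight]
    exact Real.rpow_le_rpow (by positivity) (by linarith) (by linarith)

theorem OuterExpansion.norm_eq_one {Ωp Ωm : Set ℂ} {O' cζ : ℂ} {ζ : ℂ → ℂ}
    (hflux : μ * ∫ θ in (0 : ℝ)..Real.pi, sigmaAngle σp σm θ * phi μ c θ ^ 2 ≠ 0)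
    (hψ : IsCutoff ψ) (hβ : 0 < β) (hgeo : OuterGeometry Ω Ωp Ωm O')
    (hker : MemKer Ω (coeff σp σm Ωp Ωm) outerWeight β ζ)
    (hexp : OuterExpansion Ω ψ β μ c ζ cζ) : ‖cζ‖ = 1 := by
  obtain ⟨v, hv, hζ⟩ := hexp
  have hpos (z : ℂ) (hz : z ∈ Ω) : 0 < outerWeight z :=
    norm_pos_iff.2 fun h => hgeo.zero_notMem (h ▸ hz)
  have hvanish (r : ℝ) (hr : r ≤ 1) : 1 - ψ r = 0 := sub_eq_zero.2 (hψ.2.2.1 r hr).symm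
  have hwave : ∀ᵐ z, z ∈ Ω ∩ Metric.ball 0 1 → ζ z = wave μ (phi μ c) 1 cζ z + v z := by
    filter_upwards [(ae_restrict_iff' hgeo.isOpen.measurableSet).1 hζ] with z hz hzW
    rw [hz hzW.1, hψ.2.2.1 ‖z‖ (mem_ball_zero_iff.1 hzW.2).le, Complex.ofReal_one, one_mul,
      one_mul, wave, one_mul, singular, singular, angularWave, angularWave]
  rw [← hgeo.isSectorial.norm_eq_of_expansion hflux hgeo.isOpen Metric.isOpen_ball continuous_norm
    hpos hψ.isTransition.one_sub (fun ε => exists_isFluxScale_outerWeight Ω hβ hvanish) hker hv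
    hwave, norm_one]

theorem InnerExpansion.norm_eq_one {Ξp Ξm : Set ℂ} {γ : ℝ → ℂ} {Z : ℂ → ℂ} {CZ : ℂ}
    (hflux : μ * ∫ θ in (0 : ℝ)..Real.pi, sigmaAngle σp σm θ * phi μ c θ ^ 2 ≠ 0)
    (hψ : IsCutoff ψ) (hβ : 0 < β) (hgeo : InnerGeometry Ξp Ξm γ)
    (hker : MemKer Xi (coeff σp σm Ξp Ξm) innerWeight (-β) Z)
    (hexp : InnerExpansion ψ β μ c Z CZ) : ‖CZ‖ = 1 := by
  obtain ⟨v, hv, hZ⟩ := hexp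
  obtain ⟨R, hR⟩ := hgeo.exists_isSectorial
  have hpos (z : ℂ) (_ : z ∈ Xi) : 0 < innerWeight z := by
    rw [innerWeight]
    positivity
  have hwave : ∀ᵐ z, z ∈ Xi ∩ {z | max R 2 < ‖z‖} →
      Z z = wave μ (phi μ c) CZ 1 z + v z := by
    filter_upwards [(ae_restrict_iff' isOpen_Xi.measurableSet).1 hZ] with z hz hzW
    rw [hz hzW.1, hψ.2.2.2 ‖z‖ ((le_max_right R 2).trans (le_of_lt hzW.2)), sub_zero,
      Complex.ofReal_one, one_mul, one_mul, wave, one_mul, singular, singular, angularWave,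
      angularWave, add_comm (CZ * _)]
  rw [(hR _ (le_max_left R 2)).norm_eq_of_expansion hflux isOpen_Xi
    (isOpen_lt continuous_const continuous_norm) (continuous_const.add continuous_norm) hpos
    hψ.isTransition (fun ε => exists_isFluxScale_innerWeight Xi hβ hψ.2.2.2 _) hker
    (by rwa [neg_neg]) hwave, norm_one]

end Corner

end SignChanging

end

theorem lemma4p1_general (σp σm μ c : ℝ)
    (hflux : μ * ∫ θ in (0 : ℝ)..Real.pi,
      SignChanging.sigmaAngle σp σm θ * SignChanging.phi μ c θ ^ 2 ≠ 0)
    (ψ : ℝ → ℝ) (hψ : SignChanging.IsCutoff ψ) (β : ℝ) (hβ : 0 < β) :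
    (∀ (Ω Ωp Ωm : Set ℂ) (O' : ℂ), SignChanging.OuterGeometry Ω Ωp Ωm O' →
      ∀ (ζ : ℂ → ℂ) (cζ : ℂ),
        SignChanging.MemKer Ω (SignChanging.coeff σp σm Ωp Ωm) SignChanging.outerWeight β ζ →
        SignChanging.OuterExpansion Ω ψ β μ c ζ cζ →
        ‖cζ‖ = 1) ∧
    (∀ (Ξp Ξm : Set ℂ) (γ : ℝ → ℂ), SignChanging.InnerGeometry Ξp Ξm γ →
      ∀ (Z : ℂ → ℂ) (CZ : ℂ),
        SignChanging.MemKer SignChanging.Xi (SignChanging.coeff σp σm Ξp Ξm)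
          SignChanging.innerWeight (-β) Z →
        SignChanging.InnerExpansion ψ β μ c Z CZ →
        ‖CZ‖ = 1) :=
  ⟨fun _ _ _ _ hgeo _ _ hker hexp => hexp.norm_eq_one hflux hψ hβ hgeo hker,
    fun _ _ _ hgeo _ _ hker hexp => hexp.norm_eq_one hflux hψ hβ hgeo hker⟩

theorem lemma4p1 (σp σm : ℝ) (hσp : 0 < σp) (hσm : σm < 0)
    (hκ : σm / σp ∈ Set.Ioo (-1 : ℝ) (-1 / 3))
    (cφ : ℝ) (hφ : SignChanging.IsNormalized σp σm cφ)
    (ψ : ℝ → ℝ) (hψ : SignChanging.IsCutoff ψ)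
    (β : ℝ) (hβ : β ∈ Set.Ioo (0 : ℝ) 2) :
    (∀ (Ω Ωp Ωm : Set ℂ) (O' : ℂ), SignChanging.OuterGeometry Ω Ωp Ωm O' →
      ∀ (ζ : ℂ → ℂ) (cζ : ℂ),
        SignChanging.MemKer Ω (SignChanging.coeff σp σm Ωp Ωm) SignChanging.outerWeight β ζ →
        SignChanging.OuterExpansion Ω ψ β (SignChanging.mu σp σm) cφ ζ cζ →
        ‖cζ‖ = 1) ∧
    (∀ (Ξp Ξm : Set ℂ) (γ : ℝ → ℂ), SignChanging.InnerGeometry Ξp Ξm γ →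
      ∀ (Z : ℂ → ℂ) (CZ : ℂ),
        SignChanging.MemKer SignChanging.Xi (SignChanging.coeff σp σm Ξp Ξm)
          SignChanging.innerWeight (-β) Z →
        SignChanging.InnerExpansion ψ β (SignChanging.mu σp σm) cφ Z CZ →
        ‖CZ‖ = 1) := by
  exact lemma4p1_general σp σm (SignChanging.mu σp σm) cφ (hφ.trans_ne one_ne_zero) ψ hψ β hβ.1
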